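/- Fix an integer $N\ge 1$ and let $p=p_F:=1+\frac2N$. For $0<\alpha<1$ consider $$\partial_t^\alpha u-\Delta u=u^p\ \text{ in }(0,T)\times\mathbb R^N,\qquad u(0)=\mu\ \text{ in }\mathbb R^N, \tag{P}$$ where $\partial_t^\alpha$ is the Caputo derivative and $\mu$ is a nonnegative Radon measure on $\mathbb R^N$; a nonnegative locally integrable function is identified with its density measure. Let $e^{t\Delta}\mu(x)=\int_{\mathbb R^N}(4\pi t)^{-N/2}e^{-|x-y|^2/(4t)}\,d\mu(y)$, let $h_\alpha(\theta)=\sum_{n\ge0}\frac{(-\theta)^n}{n!\,\Gamma(1-\alpha-\alpha n)}$ (with $1/\Gamma=0$ at the poles of $\Gamma$; this is a positive probability density on $(0,\infty)$, with $\int_0^\infty h_\alpha(\theta)e^{z\theta}d\theta=\sum_{k\ge 0} z^k/\Gamma(\alpha k+1)$), and $$P_\alpha(t)=\int_0^\infty h_\alpha(\theta)e^{t^\alpha\theta\Delta}\,d\theta,\qquad S_\alpha(t)=\int_0^\infty\theta h_\alpha(\theta)e^{t^\alpha\theta\Delta}\,d\theta .$$ For $0<T<\infty$, a nonnegative measurable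 function $u$ on $(0,T]\times\mathbb R^N$ is a solution of (P) in $[0,T]\times\mathbb R^N$ if $$\infty>u(t,x)=[P_\alpha(t)\mu](x)+\alpha\int_0^t(t-s)^{\alpha-1}[S_\alpha(t-s)u(s)^p](x)\,ds$$ for almost all $t\in(0,T]$ and $x\in\mathbb R^N$. It is the minimal solution if $u\le v$ almost everywhere for every solution $v$ in $[0,T]\times\mathbb R^N$. The life span is $$T_\alpha[\mu]:=\sup\{T'>0:\ \text{the minimal solution of (P) exists in }[0,T']\times\mathbb R^N\}\in[0,\infty].$$ For an integer $j\ge1$ let $\psi_j:=j\chi_{B(0,r_j)}$ with $r_j:=(j\omega_N)^{-1/N}$, where $\omega_N$ is the volume of the unit ball of $\mathbb R^N$. **Theorem.** There exists a function $\kappa_1:(0,1)\to(0,\infty)$ (depending on $N$) such that: 1. for every $\alpha\in(0,1)$ and every $\kappa>\kappa_1(\alpha)$ there is a constant $C_\kappa>0$ (depending on $N,\alpha,\kappa$ but not on $j$) with $$T_\alpha[\kappa\psi_j]\le C_\kappa\, j^{-\frac{2}{\alpha N}}\qquad\text{for all integers } j\ge1;$$ 2. $\kappa_1(\alpha)\simeq(1-\alpha)^{N/2}$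 as $\alpha\to1-0$, that is, there are constants $0<c\le C$ (depending on $N$) with $c(1-\alpha)^{N/2}\le\kappa_1(\alpha)\le C(1-\alpha)^{N/2}$ for all $\alpha<1$ sufficiently close to $1$; 3. for every $\alpha\in(0,1)$ there are $K>0$ and $C>0$ (depending on $N,\alpha$) such that for all $\kappa>K$ one can take $C_\kappa=C\kappa^{-\frac{2}{\alpha N}}$, that is, $T_\alpha[\kappa\psi_j]\le C\kappa^{-\frac{2}{\alpha N}}j^{-\frac{2}{\alpha N}}$ for all integers $j\ge1$. -/

import Mathlib

open MeasureTheory Set Filter Topology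
open scoped ENNReal

noncomputable section

namespace TimeFracHeat

/-- The space `ℝ^N` with its Euclidean norm and Lebesgue measure. -/
abbrev Space (N : ℕ) : Type := EuclideanSpace ℝ (Fin N)

/-- The heat kernel `G(t,x) = (4πt)^{-N/2} exp(-|x|²/(4t))`, for `t > 0`. -/
def heatKernel (N : ℕ) (t : ℝ) (x : Space N) : ℝ :=
  ((4 * Real.pi * t) ^ ((N : ℝ) / 2))⁻¹ * Real.exp (-(‖x‖ ^ 2) / (4 * t))

/-- `(e^{tΔ} μ)(x) = ∫ G(t, x - y) dμ(y)`, with values in `[0,∞]`. -/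
def heat {N : ℕ} (t : ℝ) (μ : Measure (Space N)) (x : Space N) : ℝ≥0∞ :=
  ∫⁻ y, ENNReal.ofReal (heatKernel N t (x - y)) ∂μ

/-- The probability density `h_α` on `(0,∞)`: the Wright-type (Mainardi) function
`h_α(θ) = ∑ₙ (-θ)ⁿ / (n! Γ(1 - α - αn))`, which is the density whose Laplace transform is
`∫₀^∞ h_α(θ) e^{zθ} dθ = E_{α,1}(z)`. The series converges for all real `θ` when `0 < α < 1`.
The reciprocal `1/Γ` is `0` at the poles of `Γ`, in agreement with the entire function `1/Γ`
(Mathlib sets `Γ` to `0` there, and `0⁻¹ = 0`). -/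
def wrightDensity (α θ : ℝ) : ℝ :=
  ∑' n : ℕ, (-θ) ^ n * ((n.factorial : ℝ)⁻¹ * (Real.Gamma (1 - α - α * n))⁻¹)

/-- `P_α(t) μ = ∫₀^∞ h_α(θ) e^{t^α θ Δ} μ dθ`. -/
def opP {N : ℕ} (α t : ℝ) (μ : Measure (Space N)) (x : Space N) : ℝ≥0∞ :=
  ∫⁻ θ in Ioi (0 : ℝ), ENNReal.ofReal (wrightDensity α θ) * heat (t ^ α * θ) μ x

/-- `S_α(t) μ = ∫₀^∞ θ h_α(θ) e^{t^α θ Δ} μ dθ`. -/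
def opS {N : ℕ} (α t : ℝ) (μ : Measure (Space N)) (x : Space N) : ℝ≥0∞ :=
  ∫⁻ θ in Ioi (0 : ℝ), ENNReal.ofReal (θ * wrightDensity α θ) * heat (t ^ α * θ) μ x

/-- The set `(0,T] × ℝ^N`. -/
def cylinder (N : ℕ) (T : ℝ) : Set (ℝ × Space N) := Ioc 0 T ×ˢ univ

/-- `u` is a solution in `[0,T] × ℝ^N` of `∂_t^α u - Δu = u^p`, `u(0) = μ`: it is a nonnegative
(Lebesgue) measurable function on `(0,T] × ℝ^N`, and for almost all `(t,x)` there
`∞ > u(t,x) = [P_α(t)μ](x) + α ∫₀ᵗ (t-s)^{α-1} [S_α(t-s) u(s)^p](x) ds`.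
The function `u(s)^p` is identified with the measure `u(s,y)^p dy`. -/
structure IsSolution {N : ℕ} (α p T : ℝ) (μ : Measure (Space N))
    (u : ℝ × Space N → ℝ≥0∞) : Prop where
  aemeasurable : AEMeasurable u (volume.restrict (cylinder N T))
  eqn : ∀ᵐ z ∂(volume.restrict (cylinder N T)),
    u z < ∞ ∧
    u z = opP α z.1 μ z.2 + ENNReal.ofReal α *
      ∫⁻ s in Ioo 0 z.1, ENNReal.ofReal ((z.1 - s) ^ (α - 1)) *
        opS α (z.1 - s) (volume.withDensity fun y => u (s, y) ^ p) z.2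

/-- The minimal solution in `[0,T] × ℝ^N`: a solution which lies almost everywhere below every
solution in `[0,T] × ℝ^N`. -/
def IsMinimalSolution {N : ℕ} (α p T : ℝ) (μ : Measure (Space N))
    (u : ℝ × Space N → ℝ≥0∞) : Prop :=
  IsSolution α p T μ u ∧
    ∀ v, IsSolution α p T μ v → ∀ᵐ z ∂(volume.restrict (cylinder N T)), u z ≤ v z

/-- The life span `T_α[μ] ∈ [0,∞]`: the supremum of all `T > 0` such that the minimal solution
exists in `[0,T] × ℝ^N`. -/
def lifespan {N : ℕ} (α p : ℝ) (μ : Measure (Space N)) : ℝ≥0∞ :=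
  sSup {τ | ∃ T : ℝ, 0 < T ∧ τ = ENNReal.ofReal T ∧ ∃ u, IsMinimalSolution α p T μ u}

/-- The Fujita exponent `p_F = 1 + 2/N`. -/
def fujita (N : ℕ) : ℝ := 1 + 2 / N

/-- `ω_N`, the volume of the unit ball of `ℝ^N`. -/
def unitBallVolume (N : ℕ) : ℝ := (volume (Metric.ball (0 : Space N) 1)).toReal

/-- `r_j = (j ω_N)^{-1/N}`. -/
def radius (N j : ℕ) : ℝ := ((j : ℝ) * unitBallVolume N) ^ (-(1 / (N : ℝ)))

/-- `ψ_j = j χ_{B(0,r_j)}`. -/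
def psi (N j : ℕ) : Space N → ℝ :=
  (Metric.ball (0 : Space N) (radius N j)).indicator fun _ => (j : ℝ)

/-- The initial datum `κ ψ_j`, identified with the measure `κ ψ_j(y) dy`. -/
def initialDatum (N : ℕ) (κ : ℝ) (j : ℕ) : Measure (Space N) :=
  volume.withDensity fun y => ENNReal.ofReal (κ * psi N j y)

end TimeFracHeat

end

/-!
The only information on `h_α` which enters the estimates is that it has mass at least `c` on a fixed
interval `(a, b]` with `a > 0`. By the Gaussian lower bound for the heat kernel, the solution with
initial datum `κ ψ_j` then satisfies `u(t,x) ≥ A t^(-αN/2)` in the parabola `|x| < t^(α/2)`, with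
`A` proportional to `κ`. At the exponent `p_F` this profile is invariant under the scaling of the
equation, and feeding it into the Duhamel term reproduces it up to a constant and the factor
`∫ s^(-α) ds`, which is of order `t^(1-α) / (1 - α)`: when `A^(2/N)` exceeds a multiple of `1 - α`,
each pass multiplies `A` by a factor greater than `1`. After finitely many passes `A` is so large
that iterating a constant lower bound on a parabolic cylinder makes `u` infinite there.

The threshold is thus of order `(1 - α)^(N/2)` as soon as `a`, `b`, `c` can be chosen independently
of `α` near `1`. For this, the distribution function of `h_α` is written as the integral over `r` of
`π⁻¹ e^{-r - θ r^α cos πα} sin (θ r^α sin πα) / r`, which is bounded below at a suitable `θ`.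
-/

noncomputable section

namespace TimeFracHeat

open Real

/-! ### Lower bounds for the heat flow and for solutions -/

theorem unitBallVolume_pos (N : ℕ) : 0 < unitBallVolume N :=
  ENNReal.toReal_pos (Metric.measure_ball_pos _ _ one_pos).ne' measure_ball_lt_top.ne

theorem volume_ball_eq {N : ℕ} (x : Space N) {R : ℝ} (hR : 0 < R) :
    volume (Metric.ball x R) = ENNReal.ofReal (R ^ N * unitBallVolume N) := by
  rw [Measure.addHaar_ball_of_pos _ _ hR, ENNReal.ofReal_mul (by positivity), unitBallVolume,
    ENNReal.ofReal_toReal measure_ball_lt_top.ne, finrank_euclideanSpace_fin]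

theorem heatKernel_ge {N : ℕ} {a b L τ : ℝ} {z : Space N} (ha : 0 < a) (hL : 0 < L)
    (haτ : a * L ^ 2 ≤ τ) (hτb : τ ≤ b * L ^ 2) (hz : ‖z‖ ≤ 2 * L) :
    ((4 * π * b) ^ ((N : ℝ) / 2))⁻¹ * exp (-1 / a) / L ^ N ≤ heatKernel N τ z := by
  have hτ : 0 < τ := haτ.trans_lt' (by positivity)
  have hb : 0 < b := pos_of_mul_pos_left (hτ.trans_le hτb) (by positivity)
  have hprefactor : (4 * π * τ) ^ ((N : ℝ) / 2) ≤ (4 * π * b) ^ ((N : ℝ) / 2) * L ^ N := by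
    calc (4 * π * τ) ^ ((N : ℝ) / 2) ≤ (4 * π * b * L ^ 2) ^ ((N : ℝ) / 2) := by
          rw [mul_assoc _ b]
          gcongr
      _ = (4 * π * b) ^ ((N : ℝ) / 2) * L ^ N := by
          rw [mul_rpow (by positivity) (by positivity), ← rpow_natCast_mul hL.le]
          congr 1
          rw [← rpow_natCast]
          congr 1
          push_cast
          ring
  have hexponent : -1 / a ≤ -(‖z‖ ^ 2) / (4 * τ) := by
    rw [neg_div, neg_div, neg_le_neg_iff, div_le_div_iff₀ (by positivity) ha]
    calc ‖z‖ ^ 2 * a ≤ (2 * L) ^ 2 * a := by gcongr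
      _ ≤ 1 * (4 * τ) := by linarith
  calc ((4 * π * b) ^ ((N : ℝ) / 2))⁻¹ * exp (-1 / a) / L ^ N
      = ((4 * π * b) ^ ((N : ℝ) / 2) * L ^ N)⁻¹ * exp (-1 / a) := by rw [mul_inv]; ring
    _ ≤ heatKernel N τ z := by
        unfold heatKernel
        gcongr

/-- A lower bound for `L ^ N` times the average of the heat kernel over a ball of radius `ρ ≤ L`
at distance at most `L`, for times between `a * L ^ 2` and `b * L ^ 2`, multiplied by the volume of
the unit ball; see `ofReal_le_heat_restrict_ball`. -/
def diffusionConst (N : ℕ) (a b : ℝ) : ℝ :=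
  ((4 * π * b) ^ ((N : ℝ) / 2))⁻¹ * exp (-1 / a) * unitBallVolume N

theorem diffusionConst_pos (N : ℕ) (a : ℝ) {b : ℝ} (hb : 0 < b) : 0 < diffusionConst N a b := by
  have := unitBallVolume_pos N
  unfold diffusionConst
  positivity

theorem ofReal_le_heat_restrict_ball {N : ℕ} {a b L ρ τ : ℝ} {x z : Space N} (ha : 0 < a)
    (hρ : 0 < ρ) (hρL : ρ ≤ L) (haτ : a * L ^ 2 ≤ τ) (hτb : τ ≤ b * L ^ 2) (hxz : ‖x - z‖ ≤ L) :
    ENNReal.ofReal (diffusionConst N a b * (ρ / L) ^ N) ≤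
      heat τ (volume.restrict (Metric.ball z ρ)) x := by
  have hL : 0 < L := hρ.trans_le hρL
  have hb : 0 < b :=
    pos_of_mul_pos_left ((haτ.trans_lt' (by positivity)).trans_le hτb) (by positivity)
  calc ENNReal.ofReal (diffusionConst N a b * (ρ / L) ^ N)
      = ENNReal.ofReal (((4 * π * b) ^ ((N : ℝ) / 2))⁻¹ * exp (-1 / a) / L ^ N) *
          volume (Metric.ball z ρ) := by
        rw [volume_ball_eq z hρ, ← ENNReal.ofReal_mul (by positivity), diffusionConst, div_pow]
        congr 1
        ring
    _ = ∫⁻ _ in Metric.ball z ρ,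
          ENNReal.ofReal (((4 * π * b) ^ ((N : ℝ) / 2))⁻¹ * exp (-1 / a) / L ^ N) :=
        (setLIntegral_const _ _).symm
    _ ≤ heat τ (volume.restrict (Metric.ball z ρ)) x := by
        refine setLIntegral_mono' measurableSet_ball fun y hy => ENNReal.ofReal_le_ofReal ?_
        refine heatKernel_ge ha hL haτ hτb ?_
        calc ‖x - y‖ ≤ ‖x - z‖ + ‖y - z‖ := by simpa using norm_sub_le (x - z) (y - z)
          _ ≤ 2 * L := by linarith [mem_ball_iff_norm.1 hy]

theorem exists_norm_sub_le_and_ball_subset_ball {E : Type*} [NormedAddCommGroup E]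
    [NormedSpace ℝ E] {x : E} {r R : ℝ} (hr : 0 ≤ r) (hrR : r ≤ R) (hx : ‖x‖ ≤ R) :
    ∃ z, ‖x - z‖ ≤ r ∧ Metric.ball z r ⊆ Metric.ball 0 R := by
  rcases (hr.trans hrR).eq_or_lt with rfl | hR
  · exact ⟨x, by simpa using hr, by simp [Metric.ball_eq_empty.2 hrR]⟩
  have hratio : r / R ≤ 1 := div_le_one_of_le₀ hrR hR.le
  have hxr : r / R * ‖x‖ ≤ r := by
    rw [div_mul_comm]
    exact mul_le_of_le_one_left hr (div_le_one_of_le₀ hx hR.le)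
  refine ⟨(1 - r / R) • x, ?_, Metric.ball_subset_ball' ?_⟩
  · rwa [sub_smul, one_smul, sub_sub_cancel, norm_smul, norm_of_nonneg (by positivity)]
  · rw [dist_zero_right, norm_smul, norm_of_nonneg (by linarith)]
    calc r + (1 - r / R) * ‖x‖ ≤ r + (1 - r / R) * R := by gcongr
      _ = R := by field_simp; ring

/-- A lower bound on the ball of radius `R`, up to time `R ^ 2`, for the heat flow of the
indicator function of that ball; see `ofReal_coneConst_le_heat`. -/
def coneConst (N : ℕ) : ℝ := diffusionConst N 1 1 * (1 / 2) ^ N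

theorem coneConst_pos (N : ℕ) : 0 < coneConst N :=
  mul_pos (diffusionConst_pos N 1 one_pos) (by positivity)

theorem ofReal_coneConst_le_heat {N : ℕ} {τ R : ℝ} {x : Space N} (hτ : 0 < τ) (hR : 0 ≤ R)
    (hτR : τ ≤ R ^ 2) (hx : ‖x‖ ≤ R) :
    ENNReal.ofReal (coneConst N) ≤ heat τ (volume.restrict (Metric.ball 0 R)) x := by
  have hsqrt : 0 < √τ := sqrt_pos.2 hτ
  obtain ⟨z, hxz, hball⟩ := exists_norm_sub_le_and_ball_subset_ball (r := √τ / 2) (by positivity)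
    (by linarith [sqrt_le_iff.2 ⟨hR, hτR⟩]) hx
  calc ENNReal.ofReal (coneConst N)
      = ENNReal.ofReal (diffusionConst N 1 1 * (√τ / 2 / √τ) ^ N) := by
        rw [coneConst, div_div_cancel_left' hsqrt.ne', one_div]
    _ ≤ heat τ (volume.restrict (Metric.ball z (√τ / 2))) x :=
        ofReal_le_heat_restrict_ball one_pos (by positivity) (by linarith)
          (by rw [sq_sqrt hτ.le, one_mul]) (by rw [sq_sqrt hτ.le, one_mul]) (by linarith)
    _ ≤ heat τ (volume.restrict (Metric.ball 0 R)) x := lintegral_mono_set hball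

theorem mul_heat_restrict_le_heat_withDensity {N : ℕ} {B : ℝ≥0∞} {s : Set (Space N)}
    {f : Space N → ℝ≥0∞} (hs : MeasurableSet s) (hf : ∀ᵐ y, y ∈ s → B ≤ f y) (τ : ℝ)
    (x : Space N) :
    B * heat τ (volume.restrict s) x ≤ heat τ (volume.withDensity f) x := by
  have hμ : B • volume.restrict s ≤ volume.withDensity f := by
    rw [← withDensity_const, ← withDensity_indicator hs]
    refine withDensity_mono ?_
    filter_upwards [hf] with y hy
    exact indicator_apply_le hy
  rw [heat, ← smul_eq_mul, ← lintegral_smul_measure]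
  exact lintegral_mono' hμ le_rfl

/-- The positive part of `h_α` has mass at least `c` on `(a, b]`: the only information about `h_α`
which enters the lower bounds for `P_α` and `S_α`. -/
structure WrightMass (α a b c : ℝ) : Prop where
  a_pos : 0 < a
  b_pos : 0 < b
  c_pos : 0 < c
  le_lintegral : ENNReal.ofReal c ≤ ∫⁻ θ in Ioc a b, ENNReal.ofReal (wrightDensity α θ)

section Operators

variable {N : ℕ} {α a b c t : ℝ} {μ : Measure (Space N)} {x : Space N} {l : ℝ≥0∞}

theorem ofReal_mul_le_opP (hw : WrightMass α a b c)
    (hl : ∀ θ ∈ Ioc a b, l ≤ heat (t ^ α * θ) μ x) : ENNReal.ofReal c * l ≤ opP α t μ x :=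
  calc ENNReal.ofReal c * l ≤ (∫⁻ θ in Ioc a b, ENNReal.ofReal (wrightDensity α θ)) * l := by
        gcongr
        exact hw.le_lintegral
    _ ≤ ∫⁻ θ in Ioc a b, ENNReal.ofReal (wrightDensity α θ) * l := lintegral_mul_const_le _ _
    _ ≤ ∫⁻ θ in Ioc a b, ENNReal.ofReal (wrightDensity α θ) * heat (t ^ α * θ) μ x :=
        setLIntegral_mono' measurableSet_Ioc fun θ hθ => by gcongr; exact hl θ hθ
    _ ≤ opP α t μ x := lintegral_mono_set fun _ hθ => hw.a_pos.trans hθ.1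

theorem ofReal_mul_le_opS (hw : WrightMass α a b c)
    (hl : ∀ θ ∈ Ioc a b, l ≤ heat (t ^ α * θ) μ x) : ENNReal.ofReal (a * c) * l ≤ opS α t μ x :=
  calc ENNReal.ofReal (a * c) * l = ENNReal.ofReal c * (ENNReal.ofReal a * l) := by
        rw [ENNReal.ofReal_mul hw.a_pos.le]
        ring
    _ ≤ (∫⁻ θ in Ioc a b, ENNReal.ofReal (wrightDensity α θ)) * (ENNReal.ofReal a * l) := by
        gcongr
        exact hw.le_lintegral
    _ ≤ ∫⁻ θ in Ioc a b, ENNReal.ofReal (wrightDensity α θ) * (ENNReal.ofReal a * l) :=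
        lintegral_mul_const_le _ _
    _ ≤ ∫⁻ θ in Ioc a b, ENNReal.ofReal (θ * wrightDensity α θ) * heat (t ^ α * θ) μ x := by
        refine setLIntegral_mono' measurableSet_Ioc fun θ hθ => ?_
        rw [ENNReal.ofReal_mul (hw.a_pos.trans hθ.1).le, ← mul_assoc,
          mul_comm (ENNReal.ofReal (wrightDensity α θ))]
        gcongr
        exacts [hθ.1.le, hl θ hθ]
    _ ≤ opS α t μ x := lintegral_mono_set fun _ hθ => hw.a_pos.trans hθ.1

end Operators

/-- `u(t,x) ≥ f(t)` for almost all `t ∈ (τ₀, τ₁)` and `|x| < R(t)`: the form in which lower bounds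
for a solution are propagated in time. Negative values of `f` are read as `0`. -/
def LowerBoundOn {N : ℕ} (u : ℝ × Space N → ℝ≥0∞) (τ₀ τ₁ : ℝ) (R f : ℝ → ℝ) : Prop :=
  ∀ᵐ z : ℝ × Space N, z.1 ∈ Ioo τ₀ τ₁ → ‖z.2‖ < R z.1 → ENNReal.ofReal (f z.1) ≤ u z

theorem LowerBoundOn.mono {N : ℕ} {u : ℝ × Space N → ℝ≥0∞} {τ₀ τ₀' τ₁ τ₁' : ℝ}
    {R R' f f' : ℝ → ℝ} (h : LowerBoundOn u τ₀ τ₁ R f) (hτ : Ioo τ₀' τ₁' ⊆ Ioo τ₀ τ₁)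
    (hR : ∀ t ∈ Ioo τ₀' τ₁', R' t ≤ R t) (hf : ∀ t ∈ Ioo τ₀' τ₁', f' t ≤ f t) :
    LowerBoundOn u τ₀' τ₁' R' f' :=
  Eventually.mono h fun _ hz hz1 hz2 =>
    (ENNReal.ofReal_le_ofReal (hf _ hz1)).trans (hz (hτ hz1) (hz2.trans_le (hR _ hz1)))

namespace IsSolution

variable {N : ℕ} {α p T : ℝ} {μ : Measure (Space N)} {u : ℝ × Space N → ℝ≥0∞}

theorem ae_eqn (hu : IsSolution α p T μ u) : ∀ᵐ z : ℝ × Space N, z.1 ∈ Ioc 0 T →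
    u z < ∞ ∧
    u z = opP α z.1 μ z.2 + ENNReal.ofReal α *
      ∫⁻ s in Ioo 0 z.1, ENNReal.ofReal ((z.1 - s) ^ (α - 1)) *
        opS α (z.1 - s) (volume.withDensity fun y => u (s, y) ^ p) z.2 := by
  have h := hu.eqn
  rw [cylinder, ae_restrict_iff' (measurableSet_Ioc.prod MeasurableSet.univ)] at h
  exact h.mono fun z hz hz1 => hz ⟨hz1, mem_univ _⟩

theorem ae_lt_top (hu : IsSolution α p T μ u) :
    ∀ᵐ z : ℝ × Space N, z.1 ∈ Ioc 0 T → u z < ∞ :=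
  hu.ae_eqn.mono fun _ hz hz1 => (hz hz1).1

theorem ae_opP_le (hu : IsSolution α p T μ u) :
    ∀ᵐ z : ℝ × Space N, z.1 ∈ Ioc 0 T → opP α z.1 μ z.2 ≤ u z :=
  hu.ae_eqn.mono fun _ hz hz1 => (hz hz1).2 ▸ le_self_add

theorem ae_duhamel_le (hu : IsSolution α p T μ u) :
    ∀ᵐ z : ℝ × Space N, z.1 ∈ Ioc 0 T → ENNReal.ofReal α *
      ∫⁻ s in Ioo 0 z.1, ENNReal.ofReal ((z.1 - s) ^ (α - 1)) *
        opS α (z.1 - s) (volume.withDensity fun y => u (s, y) ^ p) z.2 ≤ u z :=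
  hu.ae_eqn.mono fun _ hz hz1 => (hz hz1).2 ▸ le_add_self

theorem ae_lintegral_le {a b c τ₀ τ₁ : ℝ} {R f : ℝ → ℝ} (hu : IsSolution α p T μ u) (hα : 0 ≤ α)
    (hα1 : α ≤ 1) (hp : 0 ≤ p) (hw : WrightMass α a b c) (hτ₀ : 0 ≤ τ₀) (hτ₁ : τ₁ ≤ T)
    (hlow : LowerBoundOn u τ₀ τ₁ R f) :
    ∀ᵐ z : ℝ × Space N, z.1 ∈ Ioo τ₀ τ₁ → ∀ D, z.1 - τ₀ ≤ D → ∀ σ ≤ z.1, ∀ g : ℝ → ℝ≥0∞,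
      (∀ s ∈ Ioo τ₀ σ, ∀ θ ∈ Ioc a b, g s ≤ ENNReal.ofReal (f s) ^ p *
        heat ((z.1 - s) ^ α * θ) (volume.restrict (Metric.ball 0 (R s))) z.2) →
      ENNReal.ofReal (α * (D ^ (α - 1) * (a * c))) * ∫⁻ s in Ioo τ₀ σ, g s ≤ u z := by
  have hslice : ∀ᵐ s : ℝ, ∀ᵐ y : Space N,
      s ∈ Ioo τ₀ τ₁ → ‖y‖ < R s → ENNReal.ofReal (f s) ≤ u (s, y) :=
    Measure.ae_ae_of_ae_prod hlow
  filter_upwards [hu.ae_duhamel_le] with z hz hz1 D hD σ hσ g hg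
  have hD0 : 0 < D := (sub_pos.2 hz1.1).trans_le hD
  refine le_trans ?_ (hz ⟨hτ₀.trans_lt hz1.1, hz1.2.le.trans hτ₁⟩)
  rw [ENNReal.ofReal_mul hα, mul_assoc]
  gcongr
  refine (lintegral_const_mul_le _ _).trans ?_
  refine le_trans ?_ (lintegral_mono_set (Ioo_subset_Ioo hτ₀ hσ))
  refine lintegral_mono_ae ?_
  filter_upwards [ae_restrict_of_ae hslice, ae_restrict_mem measurableSet_Ioo] with s hs hsσ
  rw [ENNReal.ofReal_mul (by positivity), mul_assoc]
  have hweight : D ^ (α - 1) ≤ (z.1 - s) ^ (α - 1) :=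
    rpow_le_rpow_of_nonpos (by linarith [hsσ.2]) (by linarith [hsσ.1]) (by linarith)
  gcongr
  refine ofReal_mul_le_opS hw fun θ hθ => (hg s hsσ θ hθ).trans ?_
  refine mul_heat_restrict_le_heat_withDensity measurableSet_ball ?_ _ _
  filter_upwards [hs] with y hy hyR
  gcongr
  exact hy ⟨hsσ.1, (hsσ.2.trans_le hσ).trans hz1.2⟩ (mem_ball_zero_iff.1 hyR)

end IsSolution

/-! ### Blow-up from a constant lower bound on a parabolic cylinder -/

theorem fujita_sub_one (N : ℕ) : fujita N - 1 = 2 / N := by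
  rw [fujita, add_sub_cancel_left]

theorem one_lt_fujita {N : ℕ} (hN : 1 ≤ N) : 1 < fujita N :=
  lt_add_of_pos_right _ (by positivity)

section BlowUp

variable {N : ℕ} {α p T a b c τ₀ τ₁ D R B : ℝ} {μ : Measure (Space N)} {u : ℝ × Space N → ℝ≥0∞}

theorem LowerBoundOn.duhamel_const {η : ℝ} (h : LowerBoundOn u τ₀ τ₁ (fun _ => R) fun _ => B)
    (hα : 0 < α) (hα1 : α ≤ 1) (hp : 0 ≤ p) (hu : IsSolution α p T μ u) (hw : WrightMass α a b c)
    (hτ₀ : 0 ≤ τ₀) (hτ₁ : τ₁ ≤ T) (hD : τ₁ - τ₀ ≤ D) (hR : 0 ≤ R) (hDR : b * D ^ α ≤ R ^ 2)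
    (hB : 0 < B) (hη : 0 ≤ η) :
    LowerBoundOn u (τ₀ + η) τ₁ (fun _ => R) fun _ =>
      α * (D ^ (α - 1) * (a * c)) * (B ^ p * coneConst N * η) := by
  filter_upwards [hu.ae_lintegral_le hα.le hα1 hp hw hτ₀ hτ₁ h] with z hz hz1 hz2
  have hz0 : z.1 ∈ Ioo τ₀ τ₁ := ⟨by linarith [hz1.1], hz1.2⟩
  have hD0 : 0 < D := by linarith [hz0.1, hz0.2]
  have hcone := coneConst_pos N
  have ha := hw.a_pos
  have hc := hw.c_pos
  have hheat : ∀ s ∈ Ioo τ₀ z.1, ∀ θ ∈ Ioc a b, ENNReal.ofReal (B ^ p * coneConst N) ≤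
      ENNReal.ofReal B ^ p *
        heat ((z.1 - s) ^ α * θ) (volume.restrict (Metric.ball 0 R)) z.2 := by
    intro s hs θ hθ
    have hzs : 0 < z.1 - s := sub_pos.2 hs.2
    have hθ0 : 0 < θ := ha.trans hθ.1
    rw [ENNReal.ofReal_mul (by positivity), ENNReal.ofReal_rpow_of_pos hB]
    gcongr
    refine ofReal_coneConst_le_heat (by positivity) hR ?_ hz2.le
    calc (z.1 - s) ^ α * θ ≤ D ^ α * b := by
          gcongr
          exacts [by linarith [hs.1, hz1.2], hθ.2]
      _ ≤ R ^ 2 := by rwa [mul_comm]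
  refine le_trans ?_ (hz hz0 D (by linarith [hz1.2]) z.1 le_rfl _ hheat)
  rw [setLIntegral_const, volume_Ioo, ← ENNReal.ofReal_mul (by positivity),
    ← ENNReal.ofReal_mul (by positivity)]
  gcongr
  linarith [hz1.1]

/-- The threshold above which a constant lower bound on a parabolic cylinder forces blow-up; see
`IsSolution.rpow_mul_rpow_lt_blowUpConst`. The factor `2 ^ (1 / (p - 1))` is the gain in each step
of the iteration, which halves the time left. -/
def blowUpConst (N : ℕ) (α p a c : ℝ) : ℝ :=
  4 * 2 ^ (1 / (p - 1)) / (α * (a * c * coneConst N))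

theorem LowerBoundOn.iterate_const
    (h : LowerBoundOn u τ₀ (τ₀ + D) (fun _ => R) fun _ => B) (hα : 0 < α) (hα1 : α ≤ 1)
    (hp : 1 < p) (hu : IsSolution α p T μ u) (hw : WrightMass α a b c) (hτ₀ : 0 ≤ τ₀) (hD : 0 < D)
    (hDT : τ₀ + D ≤ T) (hR : 0 ≤ R) (hDR : b * D ^ α ≤ R ^ 2) (hB : 0 < B)
    (hlarge : blowUpConst N α p a c ≤ B ^ (p - 1) * D ^ α) (k : ℕ) :
    LowerBoundOn u (τ₀ + D * (1 - (1 / 2) ^ k) / 2) (τ₀ + D) (fun _ => R)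
      fun _ => B * (2 ^ (1 / (p - 1))) ^ k := by
  have hcone := coneConst_pos N
  have ha := hw.a_pos
  have hc := hw.c_pos
  set Q : ℝ := 2 ^ (1 / (p - 1)) with hQ
  have hQp : Q ^ (p - 1) = 2 := by
    rw [hQ, one_div, rpow_inv_rpow two_pos.le (sub_pos.2 hp).ne']
  rw [blowUpConst, div_le_iff₀ (by positivity), ← hQ] at hlarge
  induction k with
  | zero => simpa using h
  | succ k ih =>
    have : (0 : ℝ) < (1 / 2) ^ k := by positivity
    have hk1 : (1 / 2 : ℝ) ^ k ≤ 1 := pow_le_one₀ (by norm_num) (by norm_num)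
    have hnonneg : 0 ≤ D * (1 - (1 / 2) ^ k) / 2 := by
      have := sub_nonneg.2 hk1
      positivity
    have hstep := ih.duhamel_const hα hα1 (by linarith) hu hw (by positivity) hDT
      (D := D) (by linarith) hR hDR (by positivity) (η := D * (1 / 2) ^ k / 4) (by positivity)
    have htime : τ₀ + D * (1 - (1 / 2) ^ k) / 2 + D * (1 / 2) ^ k / 4 =
        τ₀ + D * (1 - (1 / 2) ^ (k + 1)) / 2 := by
      rw [pow_succ]
      ring
    rw [htime] at hstep
    refine hstep.mono Subset.rfl (fun _ _ => le_rfl) fun _ _ => ?_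
    have hpow : (B * Q ^ k) ^ p = B * Q ^ k * (B ^ (p - 1) * 2 ^ k) := by
      conv_lhs => rw [← add_sub_cancel 1 p]
      rw [rpow_add (by positivity), rpow_one, mul_rpow hB.le (by positivity),
        ← rpow_pow_comm (by positivity), hQp]
    have hDα : D ^ (α - 1) * D = D ^ α := by
      rw [← rpow_add_one hD.ne', sub_add_cancel]
    have htwo : (2 : ℝ) ^ k * (1 / 2) ^ k = 1 := by rw [← mul_pow]; norm_num
    calc B * Q ^ (k + 1) = B * Q ^ k * (4 * Q) / 4 := by ring
      _ ≤ B * Q ^ k * (B ^ (p - 1) * D ^ α * (α * (a * c * coneConst N))) / 4 := by gcongr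
      _ = α * (D ^ (α - 1) * (a * c)) *
            ((B * Q ^ k) ^ p * coneConst N * (D * (1 / 2) ^ k / 4)) := by
        rw [hpow, ← hDα]
        linear_combination (-(B * Q ^ k * (B ^ (p - 1) * (D ^ (α - 1) * D) *
          (α * (a * c * coneConst N))) / 4)) * htwo

theorem IsSolution.not_forall_lowerBoundOn {B : ℕ → ℝ} (hu : IsSolution α p T μ u) (hτ₀ : 0 ≤ τ₀)
    (hτ : τ₀ < τ₁) (hτ₁ : τ₁ ≤ T) (hR : 0 < R) (hB : Tendsto B atTop atTop) :
    ¬∀ k, LowerBoundOn u τ₀ τ₁ (fun _ => R) fun _ => B k := by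
  intro h
  have hnull : ∀ᵐ z : ℝ × Space N, z ∉ Ioo τ₀ τ₁ ×ˢ Metric.ball (0 : Space N) R := by
    filter_upwards [ae_all_iff.2 h, hu.ae_lt_top] with z hz hfin hmem
    have hlt := hfin ⟨hτ₀.trans_lt hmem.1.1, hmem.1.2.le.trans hτ₁⟩
    obtain ⟨k, hk⟩ := (hB.eventually_gt_atTop (u z).toReal).exists
    have hle := hz k hmem.1 (mem_ball_zero_iff.1 hmem.2)
    exact hk.not_ge ((ENNReal.ofReal_le_iff_le_toReal hlt.ne).1 hle)
  have hpos : 0 < volume (Ioo τ₀ τ₁ ×ˢ Metric.ball (0 : Space N) R) := by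
    rw [Measure.volume_eq_prod, Measure.prod_prod]
    exact ENNReal.mul_pos (by simpa using hτ) (Metric.measure_ball_pos _ _ hR).ne'
  exact hpos.ne' (measure_eq_zero_iff_ae_notMem.2 hnull)

theorem IsSolution.rpow_mul_rpow_lt_blowUpConst (hu : IsSolution α p T μ u) (hα : 0 < α)
    (hα1 : α ≤ 1) (hp : 1 < p) (hw : WrightMass α a b c) (hτ₀ : 0 ≤ τ₀) (hD : 0 < D)
    (hDT : τ₀ + D ≤ T) (hR : 0 < R) (hDR : b * D ^ α ≤ R ^ 2) (hB : 0 < B)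
    (h : LowerBoundOn u τ₀ (τ₀ + D) (fun _ => R) fun _ => B) :
    B ^ (p - 1) * D ^ α < blowUpConst N α p a c := by
  by_contra! hlarge
  have hgain : 1 < (2 : ℝ) ^ (1 / (p - 1)) :=
    one_lt_rpow one_lt_two (one_div_pos.2 (sub_pos.2 hp))
  refine hu.not_forall_lowerBoundOn (τ₀ := τ₀ + D / 2) (by positivity) (by linarith) hDT hR
    ((tendsto_pow_atTop_atTop_of_one_lt hgain).const_mul_atTop hB) fun k => ?_
  refine (h.iterate_const hα hα1 hp hu hw hτ₀ hD hDT hR.le hDR hB hlarge k).mono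
    (Ioo_subset_Ioo_left ?_) (fun _ _ => le_rfl) fun _ _ => le_rfl
  have : D * (1 - (1 / 2) ^ k) ≤ D * 1 := by gcongr; exact sub_le_self _ (by positivity)
  linarith

end BlowUp

/-! ### The self-similar lower bound -/

section SelfSimilar

variable {N : ℕ} {α T a b c A t₀ t : ℝ} {μ : Measure (Space N)} {u : ℝ × Space N → ℝ≥0∞}

theorem rpow_half_sq (ht : 0 ≤ t) : (t ^ (α / 2)) ^ 2 = t ^ α := by
  rw [← rpow_mul_natCast ht, Nat.cast_ofNat, div_mul_cancel₀ _ two_ne_zero]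

theorem ofReal_le_heat_restrict_ball_of_le_rpow {s ρ θ : ℝ} {x : Space N} (hα : 0 ≤ α)
    (hα1 : α ≤ 1) (ha : 0 < a) (ht : 0 < t) (hts : t / 2 ≤ s) (hst : s ≤ t) (hθ : θ ∈ Ioc a b)
    (hρ : 0 < ρ) (hρt : ρ ≤ t ^ (α / 2)) (hx : ‖x‖ ≤ t ^ (α / 2)) :
    ENNReal.ofReal (diffusionConst N (a / 2) b * (ρ / t ^ (α / 2)) ^ N) ≤
      heat (s ^ α * θ) (volume.restrict (Metric.ball 0 ρ)) x := by
  have hs : 0 < s := by linarith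
  refine ofReal_le_heat_restrict_ball (by positivity) hρ hρt ?_ ?_ (by rwa [sub_zero])
  · have htwo : (2 : ℝ) ^ α ≤ 2 := by
      simpa using rpow_le_rpow_of_exponent_le one_le_two hα1
    calc a / 2 * (t ^ (α / 2)) ^ 2 = t ^ α * a / 2 := by rw [rpow_half_sq ht.le]; ring
      _ ≤ (2 * s) ^ α * θ / 2 := by
          gcongr
          exacts [by linarith, hθ.1.le]
      _ = 2 ^ α * (s ^ α * θ) / 2 := by rw [mul_rpow two_pos.le hs.le, mul_assoc]
      _ ≤ 2 * (s ^ α * θ) / 2 := by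
          have := ha.trans hθ.1
          gcongr
      _ = s ^ α * θ := by ring
  · rw [rpow_half_sq ht.le, mul_comm]
    gcongr
    exacts [ha.le.trans (hθ.1.le.trans hθ.2), hθ.2]

theorem ofReal_le_lintegral_rpow_neg (hα : 0 ≤ α) (hα1 : α < 1) (ht₀ : 0 < t₀)
    (ht : 4 ^ (1 / (1 - α)) * t₀ ≤ t) :
    ENNReal.ofReal (t ^ (1 - α) / (4 * (1 - α))) ≤
      ∫⁻ s in Ioo t₀ (t / 2), ENNReal.ofReal (s ^ (-α)) := by
  have h1α : 0 < 1 - α := sub_pos.2 hα1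
  have hfour : (4 : ℝ) ≤ 4 ^ (1 / (1 - α)) :=
    self_le_rpow_of_one_le (by norm_num) (by rw [le_div_iff₀ h1α]; linarith)
  have htt₀ : t₀ ≤ t / 2 := by nlinarith
  have ht0 : 0 < t := by linarith
  have hupper : t ^ (1 - α) ≤ 2 * (t / 2) ^ (1 - α) := by
    calc t ^ (1 - α) = 2 ^ (1 - α) * (t / 2) ^ (1 - α) := by
          rw [← mul_rpow two_pos.le (by positivity), mul_div_cancel₀ _ two_ne_zero]
      _ ≤ 2 ^ (1 : ℝ) * (t / 2) ^ (1 - α) := by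
          gcongr
          exacts [one_le_two, by linarith]
      _ = 2 * (t / 2) ^ (1 - α) := by rw [rpow_one]
  have hlower : 4 * t₀ ^ (1 - α) ≤ t ^ (1 - α) := by
    calc 4 * t₀ ^ (1 - α) = (4 ^ (1 / (1 - α)) * t₀) ^ (1 - α) := by
          rw [mul_rpow (by positivity) ht₀.le, one_div, rpow_inv_rpow (by norm_num) h1α.ne']
      _ ≤ t ^ (1 - α) := by gcongr
  have hint : IntervalIntegrable (fun s : ℝ => s ^ (-α)) volume t₀ (t / 2) :=
    intervalIntegral.intervalIntegrable_rpow' (by linarith)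
  have hnonneg : 0 ≤ᵐ[volume.restrict (Ioc t₀ (t / 2))] fun s : ℝ => s ^ (-α) := by
    filter_upwards [ae_restrict_mem measurableSet_Ioc] with s hs
    exact rpow_nonneg (ht₀.trans hs.1).le _
  rw [restrict_Ioo_eq_restrict_Ioc, ← ofReal_integral_eq_lintegral_ofReal hint.1 hnonneg,
    ← intervalIntegral.integral_of_le htt₀, integral_rpow (Or.inl (by linarith)), neg_add_eq_sub]
  gcongr ENNReal.ofReal ?_
  rw [div_le_div_iff₀ (by positivity) h1α]
  nlinarith

theorem rpow_fujita_mul {s : ℝ} (hN : 1 ≤ N) (hA : 0 ≤ A) (hs : 0 < s) (ht : 0 ≤ t) :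
    (A * s ^ (-(α * N / 2))) ^ fujita N * (s ^ (α / 2) / t ^ (α / 2)) ^ N =
      A ^ fujita N * t ^ (-(α * N / 2)) * s ^ (-α) := by
  have hexp (r : ℝ) (hr : 0 ≤ r) : (r ^ (α / 2)) ^ N = r ^ (α * N / 2) := by
    rw [← rpow_mul_natCast hr, div_mul_eq_mul_div]
  have hN0 : (N : ℝ) ≠ 0 := by positivity
  rw [mul_rpow hA (by positivity), ← rpow_mul hs.le, div_pow, hexp s hs.le, hexp t ht,
    rpow_neg ht, mul_assoc, mul_assoc, mul_div_assoc', ← rpow_add hs, ← div_eq_inv_mul]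
  congr 3
  rw [fujita]
  field_simp
  ring

/-- `u(t,x) ≥ A t^(-αN/2)` in the parabola `|x| < t^(α/2)`, for times in `(t₀, T)`: the profile
is the one which is invariant under the scaling of the equation. -/
def SelfSimilarBound (α T A t₀ : ℝ) (u : ℝ × Space N → ℝ≥0∞) : Prop :=
  LowerBoundOn u t₀ T (fun t => t ^ (α / 2)) fun t => A * t ^ (-(α * N / 2))

namespace SelfSimilarBound

theorem mono {A' : ℝ} (h : SelfSimilarBound α T A t₀ u) (hA : A' ≤ A) (ht₀ : 0 ≤ t₀) :
    SelfSimilarBound α T A' t₀ u :=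
  LowerBoundOn.mono h Subset.rfl (fun _ _ => le_rfl) fun _ ht =>
    mul_le_mul_of_nonneg_right hA (rpow_nonneg (ht₀.trans ht.1.le) _)

theorem duhamel (h : SelfSimilarBound α T A t₀ u) (hN : 1 ≤ N) (hα : 0 < α) (hα1 : α < 1)
    (hu : IsSolution α (fujita N) T μ u) (hw : WrightMass α a b c) (ht₀ : 0 < t₀) (hA : 0 < A) :
    SelfSimilarBound α T
      (α * (a * c * diffusionConst N (a / 2) b) / (4 * (1 - α)) * A ^ fujita N)
      (4 ^ (1 / (1 - α)) * t₀) u := by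
  have ha := hw.a_pos
  have hc := hw.c_pos
  have hM := diffusionConst_pos N (a / 2) hw.b_pos
  set M := diffusionConst N (a / 2) b
  have hfour : (1 : ℝ) ≤ 4 ^ (1 / (1 - α)) :=
    one_le_rpow (by norm_num) (one_div_nonneg.2 (sub_pos.2 hα1).le)
  filter_upwards [hu.ae_lintegral_le hα.le hα1.le (one_pos.trans (one_lt_fujita hN)).le hw ht₀.le
    le_rfl h] with z hz hz1 hz2
  obtain ⟨t, x⟩ := z
  have htt₀ : t₀ < t := (le_mul_of_one_le_left ht₀.le hfour).trans_lt hz1.1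
  have ht : 0 < t := ht₀.trans htt₀
  have hheat : ∀ s ∈ Ioo t₀ (t / 2), ∀ θ ∈ Ioc a b,
      ENNReal.ofReal (A ^ fujita N * t ^ (-(α * N / 2)) * M) * ENNReal.ofReal (s ^ (-α)) ≤
        ENNReal.ofReal (A * s ^ (-(α * N / 2))) ^ fujita N *
          heat ((t - s) ^ α * θ) (volume.restrict (Metric.ball 0 (s ^ (α / 2)))) x := by
    intro s hs θ hθ
    have hs0 : 0 < s := ht₀.trans hs.1
    rw [← ENNReal.ofReal_mul (by positivity), mul_right_comm, ← rpow_fujita_mul hN hA.le hs0 ht.le,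
      mul_assoc, mul_comm _ M, ENNReal.ofReal_mul (by positivity),
      ENNReal.ofReal_rpow_of_pos (by positivity)]
    gcongr
    refine ofReal_le_heat_restrict_ball_of_le_rpow hα.le hα1.le ha ht ?_ ?_ hθ (by positivity) ?_
      hz2.le
    · linarith [hs.2]
    · linarith
    · gcongr
      linarith [hs.2]
  refine le_trans ?_ (hz ⟨htt₀, hz1.2⟩ t (by linarith) (t / 2) (by linarith) _ hheat)
  have hint := ofReal_le_lintegral_rpow_neg hα.le hα1 ht₀ hz1.1.le
  rw [lintegral_const_mul' _ _ ENNReal.ofReal_ne_top]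
  refine le_trans ?_ (mul_le_mul_right (mul_le_mul_right hint _) _)
  rw [← ENNReal.ofReal_mul (by positivity), ← ENNReal.ofReal_mul (by positivity)]
  apply ENNReal.ofReal_le_ofReal
  have hcancel : t ^ (α - 1) * t ^ (1 - α) = 1 := by
    rw [← rpow_add ht, sub_add_sub_cancel, sub_self, rpow_zero]
  linear_combination (-(α * (a * c * M) / (4 * (1 - α)) * A ^ fujita N *
    t ^ (-(α * N / 2)))) * hcancel

theorem iterate (h : SelfSimilarBound α T A t₀ u) (hN : 1 ≤ N) (hα : 0 < α) (hα1 : α < 1)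
    (hu : IsSolution α (fujita N) T μ u) (hw : WrightMass α a b c) (ht₀ : 0 < t₀) (hA : 0 < A)
    (hlarge : 8 * (1 - α) ≤ α * (a * c * diffusionConst N (a / 2) b) * A ^ (2 / (N : ℝ)))
    (k : ℕ) : SelfSimilarBound α T (2 ^ k * A) ((4 ^ (1 / (1 - α))) ^ k * t₀) u := by
  have ha := hw.a_pos
  have hc := hw.c_pos
  have hM := diffusionConst_pos N (a / 2) hw.b_pos
  have : 0 < 1 - α := sub_pos.2 hα1
  induction k with
  | zero => simpa using h
  | succ k ih =>
    have hstep := ih.duhamel hN hα hα1 hu hw (by positivity) (by positivity)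
    rw [← mul_assoc ((4 : ℝ) ^ (1 / (1 - α))), ← pow_succ'] at hstep
    refine hstep.mono ?_ (by positivity)
    have hA' : A ≤ 2 ^ k * A := le_mul_of_one_le_left hA.le (one_le_pow₀ one_le_two)
    have hdouble : 2 ≤ α * (a * c * diffusionConst N (a / 2) b) / (4 * (1 - α)) *
        (2 ^ k * A) ^ (2 / (N : ℝ)) := by
      rw [div_mul_eq_mul_div, le_div_iff₀ (by positivity)]
      calc 2 * (4 * (1 - α)) = 8 * (1 - α) := by ring
        _ ≤ α * (a * c * diffusionConst N (a / 2) b) * A ^ (2 / (N : ℝ)) := hlarge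
        _ ≤ α * (a * c * diffusionConst N (a / 2) b) * (2 ^ k * A) ^ (2 / (N : ℝ)) := by gcongr
    calc 2 ^ (k + 1) * A = 2 * (2 ^ k * A) := by ring
      _ ≤ α * (a * c * diffusionConst N (a / 2) b) / (4 * (1 - α)) *
            (2 ^ k * A) ^ (2 / (N : ℝ)) * (2 ^ k * A) := by gcongr
      _ = _ := by
          rw [fujita, rpow_add (by positivity), rpow_one]
          ring

theorem rpow_mul_lt_blowUpConst {δ : ℝ} (h : SelfSimilarBound α T A t₀ u) (hN : 1 ≤ N)
    (hα : 0 < α) (hα1 : α ≤ 1) (hu : IsSolution α (fujita N) T μ u) (hw : WrightMass α a b c)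
    (ht₀ : 0 < t₀) (hA : 0 < A) (hT : 2 * t₀ ≤ T) (hδ : 0 < δ) (hδ1 : δ ≤ 1)
    (hbδ : b * δ ^ α ≤ 1) :
    A ^ (2 / (N : ℝ)) * (2 ^ (-α) * δ ^ α) < blowUpConst N α (fujita N) a c := by
  have hN0 : (N : ℝ) ≠ 0 := by positivity
  have hδt₀ : δ * t₀ ≤ t₀ := mul_le_of_le_one_left ht₀.le hδ1
  have hconst : LowerBoundOn u t₀ (t₀ + δ * t₀) (fun _ => t₀ ^ (α / 2))
      fun _ => A * (2 * t₀) ^ (-(α * N / 2)) := by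
    refine LowerBoundOn.mono h (Ioo_subset_Ioo_right (by linarith)) (fun t ht => ?_) fun t ht => ?_
    · gcongr
      exact ht.1.le
    · gcongr ?_ * ?_
      exact rpow_le_rpow_of_nonpos (ht₀.trans ht.1) (by linarith [ht.2])
        (neg_nonpos.2 (by positivity))
  have hradius : b * (δ * t₀) ^ α ≤ (t₀ ^ (α / 2)) ^ 2 := by
    rw [rpow_half_sq ht₀.le, mul_rpow hδ.le ht₀.le, ← mul_assoc]
    exact mul_le_of_le_one_left (by positivity) hbδ
  refine lt_of_eq_of_lt ?_ (hu.rpow_mul_rpow_lt_blowUpConst hα hα1 (one_lt_fujita hN) hw ht₀.le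
    (by positivity) (by linarith) (by positivity) hradius (by positivity) hconst)
  have hexp : -(α * N / 2) * (2 / N) = -α := by field_simp
  have hcancel : t₀ ^ (-α) * t₀ ^ α = 1 := by
    rw [← rpow_add ht₀, neg_add_cancel, rpow_zero]
  rw [fujita_sub_one, mul_rpow hA.le (by positivity), ← rpow_mul (by positivity), hexp,
    mul_rpow hδ.le ht₀.le, mul_rpow two_pos.le ht₀.le]
  linear_combination (-(A ^ (2 / (N : ℝ)) * (2 ^ (-α) * δ ^ α))) * hcancel

end SelfSimilarBound

end SelfSimilar

/-! ### The initial data and the life span -/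

section Lifespan

variable {N j : ℕ} {α T D a b c κ : ℝ} {u : ℝ × Space N → ℝ≥0∞}

theorem radius_pos (N : ℕ) (hj : 1 ≤ j) : 0 < radius N j := by
  have := unitBallVolume_pos N
  unfold radius
  positivity

theorem radius_rpow (N j : ℕ) (q : ℝ) :
    radius N j ^ q = (j : ℝ) ^ (-(q / N)) * unitBallVolume N ^ (-(q / N)) := by
  have := unitBallVolume_pos N
  rw [radius, ← rpow_mul (by positivity), mul_rpow (by positivity) this.le, neg_mul,
    one_div_mul_eq_div]

theorem mul_radius_pow (hN : 1 ≤ N) (hj : 1 ≤ j) : j * radius N j ^ N = (unitBallVolume N)⁻¹ := by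
  have hj0 : (j : ℝ) ≠ 0 := by positivity
  have hN0 : (N : ℝ) ≠ 0 := by positivity
  rw [← rpow_natCast, radius_rpow, div_self hN0, rpow_neg_one, rpow_neg_one,
    mul_inv_cancel_left₀ hj0]

theorem mul_heat_restrict_ball_le_heat_initialDatum (κ τ : ℝ) (x : Space N) :
    ENNReal.ofReal (κ * j) * heat τ (volume.restrict (Metric.ball 0 (radius N j))) x ≤
      heat τ (initialDatum N κ j) x :=
  mul_heat_restrict_le_heat_withDensity measurableSet_ball
    (ae_of_all _ fun y hy => by rw [psi, indicator_of_mem hy]) τ x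

theorem IsSolution.selfSimilarBound_initialDatum (hN : 1 ≤ N) (hj : 1 ≤ j) (hα : 0 < α)
    (hα1 : α ≤ 1) (hκ : 0 ≤ κ) {p : ℝ} (hu : IsSolution α p T (initialDatum N κ j) u)
    (hw : WrightMass α a b c) :
    SelfSimilarBound α T (κ * (c * diffusionConst N (a / 2) b / unitBallVolume N))
      (radius N j ^ (2 / α)) u := by
  have hρ := radius_pos N hj
  have hc := hw.c_pos
  have hM := diffusionConst_pos N (a / 2) hw.b_pos
  set M := diffusionConst N (a / 2) b
  filter_upwards [hu.ae_opP_le] with ⟨t, x⟩ hz hz1 hz2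
  have ht : 0 < t := hz1.1.trans' (by positivity)
  have hρt : radius N j ≤ t ^ (α / 2) := by
    calc radius N j = (radius N j ^ (2 / α)) ^ (α / 2) := by
          rw [← inv_div α 2, rpow_inv_rpow hρ.le (by positivity)]
      _ ≤ t ^ (α / 2) := by gcongr; exact hz1.1.le
  have hheat : ∀ θ ∈ Ioc a b, ENNReal.ofReal (κ * j) *
      ENNReal.ofReal (M * (radius N j / t ^ (α / 2)) ^ N) ≤
        heat (t ^ α * θ) (initialDatum N κ j) x := fun θ hθ =>
    (mul_le_mul_right (ofReal_le_heat_restrict_ball_of_le_rpow hα.le hα1 hw.a_pos ht (by linarith)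
      le_rfl hθ hρ hρt hz2.le) _).trans (mul_heat_restrict_ball_le_heat_initialDatum κ _ x)
  refine le_trans (le_of_eq ?_) ((ofReal_mul_le_opP hw hheat).trans (hz ⟨ht, hz1.2.le⟩))
  rw [← ENNReal.ofReal_mul (by positivity), ← ENNReal.ofReal_mul hc.le, div_eq_mul_inv _
    (unitBallVolume N), ← mul_radius_pow hN hj, div_pow, ← rpow_mul_natCast ht.le,
    div_mul_eq_mul_div, rpow_neg ht.le]
  congr 1
  ring

/-- The factor in the threshold `κ₁(α) = thresholdConst N a b c * ((1 - α) / α) ^ (N / 2)` which is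
obtained when `h_α` has mass at least `c` on `(a, b]`. -/
def thresholdConst (N : ℕ) (a b c : ℝ) : ℝ :=
  unitBallVolume N / (c * diffusionConst N (a / 2) b) *
    (8 / (a * c * diffusionConst N (a / 2) b)) ^ ((N : ℝ) / 2)

theorem WrightMass.thresholdConst_pos (hw : WrightMass α a b c) (N : ℕ) :
    0 < thresholdConst N a b c := by
  have := unitBallVolume_pos N
  have := diffusionConst_pos N (a / 2) hw.b_pos
  have := hw.a_pos
  have := hw.c_pos
  unfold thresholdConst
  positivity

theorem WrightMass.le_rpow_of_thresholdConst_lt (hw : WrightMass α a b c) (hN : 1 ≤ N)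
    (hα : 0 < α) (hα1 : α < 1) (hκ : thresholdConst N a b c * ((1 - α) / α) ^ ((N : ℝ) / 2) < κ) :
    8 * (1 - α) ≤ α * (a * c * diffusionConst N (a / 2) b) *
      (κ * (c * diffusionConst N (a / 2) b / unitBallVolume N)) ^ (2 / (N : ℝ)) := by
  have hω := unitBallVolume_pos N
  have hM := diffusionConst_pos N (a / 2) hw.b_pos
  have ha := hw.a_pos
  have hc := hw.c_pos
  have h1α : 0 < 1 - α := sub_pos.2 hα1
  rw [thresholdConst, mul_assoc, ← mul_rpow (by positivity) (by positivity), div_mul_eq_mul_div,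
    div_lt_iff₀ (by positivity), mul_comm, ← lt_div_iff₀ hω, mul_div_assoc, div_mul_div_comm,
    mul_comm _ α, ← inv_div 2 (N : ℝ)] at hκ
  have hκ0 : 0 ≤ κ * (c * diffusionConst N (a / 2) b / unitBallVolume N) :=
    hκ.le.trans' (by positivity)
  rw [← div_le_iff₀' (by positivity), ← rpow_inv_le_iff_of_pos (by positivity) hκ0
    (by positivity)]
  exact hκ.le

theorem exists_pos_mul_rpow_le_one (hα : 0 < α) (hb : 0 < b) :
    ∃ δ : ℝ, 0 < δ ∧ δ ≤ 1 ∧ b * δ ^ α ≤ 1 := by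
  refine ⟨min 1 (b⁻¹ ^ α⁻¹), by positivity, min_le_left _ _, ?_⟩
  calc b * min 1 (b⁻¹ ^ α⁻¹) ^ α ≤ b * (b⁻¹ ^ α⁻¹) ^ α := by
        gcongr
        exact min_le_right _ _
    _ = 1 := by rw [rpow_inv_rpow (by positivity) hα.ne', mul_inv_cancel₀ hb.ne']

theorem WrightMass.exists_forall_le_of_thresholdConst_lt (hw : WrightMass α a b c) (hN : 1 ≤ N)
    (hα : 0 < α) (hα1 : α < 1) (hκ : thresholdConst N a b c * ((1 - α) / α) ^ ((N : ℝ) / 2) < κ) :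
    ∃ C : ℝ, 0 < C ∧ ∀ j : ℕ, 1 ≤ j → ∀ T u, IsSolution α (fujita N) T (initialDatum N κ j) u →
      T ≤ C * (j : ℝ) ^ (-(2 / (α * (N : ℝ)))) := by
  have hω := unitBallVolume_pos N
  have hM := diffusionConst_pos N (a / 2) hw.b_pos
  have hc := hw.c_pos
  have hκ0 : 0 < κ := by
    have := hw.thresholdConst_pos N
    have := sub_pos.2 hα1
    exact hκ.trans' (by positivity)
  have hlarge := hw.le_rpow_of_thresholdConst_lt hN hα hα1 hκ
  set A := κ * (c * diffusionConst N (a / 2) b / unitBallVolume N)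
  have hA : 0 < A := by positivity
  obtain ⟨δ, hδ, hδ1, hbδ⟩ := exists_pos_mul_rpow_le_one hα hw.b_pos
  obtain ⟨k, hk⟩ : ∃ k : ℕ, blowUpConst N α (fujita N) a c ≤
      (2 ^ k * A) ^ (2 / (N : ℝ)) * (2 ^ (-α) * δ ^ α) := by
    have hprofile : Tendsto (fun k : ℕ => (2 : ℝ) ^ k * A) atTop atTop :=
      (tendsto_pow_atTop_atTop_of_one_lt one_lt_two).atTop_mul_const hA
    have hrpow := (tendsto_rpow_atTop (by positivity : 0 < 2 / (N : ℝ))).comp hprofile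
    exact ((hrpow.atTop_mul_const (by positivity)).eventually_ge_atTop _).exists
  refine ⟨2 * (4 ^ (1 / (1 - α))) ^ k * unitBallVolume N ^ (-(2 / (α * N))), by positivity,
    fun j hj T u hu => ?_⟩
  have hρ := radius_pos N hj
  by_contra! hT
  refine hk.not_gt (((hu.selfSimilarBound_initialDatum hN hj hα hα1.le hκ0.le hw).iterate hN hα hα1
    hu hw (by positivity) hA hlarge k).rpow_mul_lt_blowUpConst hN hα hα1.le hu hw (by positivity)
    (by positivity) ?_ hδ hδ1 hbδ)
  rw [radius_rpow, div_div]
  linarith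

theorem IsSolution.rpow_mul_rpow_lt_of_initialDatum (hN : 1 ≤ N) (hj : 1 ≤ j) (hα : 0 < α)
    (hα1 : α ≤ 1) (hκ : 0 < κ) (hu : IsSolution α (fujita N) T (initialDatum N κ j) u)
    (hw : WrightMass α a b c) (hD : 0 < D) (hDT : D ≤ T) (hDρ : b * D ^ α ≤ radius N j ^ 2) :
    (c * (κ * j * coneConst N)) ^ (2 / (N : ℝ)) * D ^ α < blowUpConst N α (fujita N) a c := by
  have hρ := radius_pos N hj
  have hc := hw.c_pos
  have hcone := coneConst_pos N
  have hconst : LowerBoundOn u 0 (0 + D) (fun _ => radius N j)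
      fun _ => c * (κ * j * coneConst N) := by
    rw [zero_add]
    filter_upwards [hu.ae_opP_le] with ⟨t, x⟩ hz hz1 hz2
    refine le_trans ?_ (hz ⟨hz1.1, hz1.2.le.trans hDT⟩)
    rw [ENNReal.ofReal_mul hc.le, ENNReal.ofReal_mul (by positivity)]
    refine ofReal_mul_le_opP hw fun θ hθ => ?_
    refine le_trans ?_ (mul_heat_restrict_ball_le_heat_initialDatum κ _ x)
    have ht : 0 < t := hz1.1
    have hθ0 : 0 < θ := hw.a_pos.trans hθ.1
    gcongr
    refine ofReal_coneConst_le_heat (by positivity) hρ.le ?_ hz2.le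
    calc t ^ α * θ ≤ D ^ α * b := by
          gcongr
          exacts [hz1.2.le, hθ.2]
      _ ≤ radius N j ^ 2 := by rwa [mul_comm]
  rw [← fujita_sub_one]
  exact hu.rpow_mul_rpow_lt_blowUpConst hα hα1 (one_lt_fujita hN) hw le_rfl hD (by rwa [zero_add])
    hρ hDρ (by positivity) hconst

theorem WrightMass.exists_forall_le_of_large (hw : WrightMass α a b c) (hN : 1 ≤ N)
    (hα : 0 < α) (hα1 : α ≤ 1) :
    ∃ K C : ℝ, 0 < K ∧ 0 < C ∧ ∀ κ : ℝ, K < κ → ∀ j : ℕ, 1 ≤ j → ∀ T u,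
      IsSolution α (fujita N) T (initialDatum N κ j) u →
        T ≤ C * κ ^ (-(2 / (α * (N : ℝ)))) * (j : ℝ) ^ (-(2 / (α * (N : ℝ)))) := by
  have hω := unitBallVolume_pos N
  have hcone := coneConst_pos N
  have ha := hw.a_pos
  have hb := hw.b_pos
  have hc := hw.c_pos
  set M := blowUpConst N α (fujita N) a c / (c * coneConst N) ^ (2 / (N : ℝ)) with hMdef
  have hM : 0 < M := by
    rw [hMdef, blowUpConst]
    positivity
  refine ⟨unitBallVolume N * (b * M) ^ (2 / (N : ℝ))⁻¹, M ^ α⁻¹, by positivity, by positivity,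
    fun κ hκ j hj T u hu => ?_⟩
  have hj0 : (0 : ℝ) < j := by positivity
  have hκ0 : 0 < κ := hκ.trans' (by positivity)
  have hlarge : b * M ≤ (κ / unitBallVolume N) ^ (2 / (N : ℝ)) := by
    rw [← rpow_inv_le_iff_of_pos (by positivity) (by positivity) (by positivity),
      le_div_iff₀' hω]
    exact hκ.le
  by_contra! hT
  set D := M ^ α⁻¹ * κ ^ (-(2 / (α * (N : ℝ)))) * (j : ℝ) ^ (-(2 / (α * (N : ℝ)))) with hDdef
  have hDα : D ^ α = M * (κ * j) ^ (-(2 / (N : ℝ))) := by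
    have hexp : -(2 / (α * (N : ℝ))) * α = -(2 / (N : ℝ)) := by field_simp
    rw [hDdef, mul_assoc, ← mul_rpow hκ0.le hj0.le, mul_rpow (by positivity) (by positivity),
      rpow_inv_rpow hM.le hα.ne', ← rpow_mul (by positivity), hexp]
  have hDρ : b * D ^ α ≤ radius N j ^ 2 := by
    rw [← rpow_natCast, radius_rpow, Nat.cast_ofNat]
    calc b * D ^ α ≤ (κ / unitBallVolume N) ^ (2 / (N : ℝ)) * (κ * j) ^ (-(2 / (N : ℝ))) := by
          rw [hDα, ← mul_assoc]
          gcongr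
      _ = (j : ℝ) ^ (-(2 / (N : ℝ))) * unitBallVolume N ^ (-(2 / (N : ℝ))) := by
          rw [div_rpow hκ0.le hω.le, mul_rpow hκ0.le hj0.le, rpow_neg hκ0.le, rpow_neg hω.le]
          field_simp
  refine (hu.rpow_mul_rpow_lt_of_initialDatum hN hj hα hα1 hκ0 hw (by positivity) hT.le hDρ).ne ?_
  have hfactor : c * (κ * j * coneConst N) = c * coneConst N * (κ * j) := by ring
  rw [hDα, hfactor, mul_rpow (by positivity) (by positivity), rpow_neg (by positivity), hMdef]
  field_simp

theorem lifespan_le {p X : ℝ} {μ : Measure (Space N)}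
    (h : ∀ T u, IsSolution α p T μ u → T ≤ X) : lifespan α p μ ≤ ENNReal.ofReal X := by
  refine sSup_le ?_
  rintro τ ⟨T, -, rfl, u, hu⟩
  exact ENNReal.ofReal_le_ofReal (h T u hu.1)

end Lifespan

/-! ### The density h_α -/

section WrightDensity

variable {α θ : ℝ}

theorem inv_Gamma_one_sub {z : ℝ} (hz : 0 < z) : (Gamma (1 - z))⁻¹ = Gamma z * sin (π * z) / π := by
  rw [mul_div_assoc, ← inv_div, ← Gamma_mul_Gamma_one_sub, mul_inv,
    mul_inv_cancel_left₀ (Gamma_pos_of_pos hz).ne']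

theorem Gamma_add_le {x : ℝ} (hx : 0 < x) (hα : 0 < α) (hα1 : α < 1) :
    Gamma (x + α) ≤ x ^ α * Gamma x := by
  have hΓ := Gamma_pos_of_pos hx
  calc Gamma (x + α) = Gamma ((1 - α) * x + α * (x + 1)) := by ring_nf
    _ ≤ Gamma x ^ (1 - α) * Gamma (x + 1) ^ α :=
        Gamma_mul_add_mul_le_rpow_Gamma_mul_rpow_Gamma hx (by positivity) (sub_pos.2 hα1) hα
          (sub_add_cancel _ _)
    _ = x ^ α * (Gamma x ^ (1 - α) * Gamma x ^ α) := by
        rw [Gamma_add_one hx.ne', mul_rpow hx.le hΓ.le]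
        ring
    _ = x ^ α * Gamma x := by rw [← rpow_add hΓ, sub_add_cancel, rpow_one]

theorem Gamma_le_inv (hα : 0 < α) (hα1 : α < 1) : Gamma α ≤ α⁻¹ := by
  have h := Gamma_add_le one_pos hα hα1
  rwa [add_comm, Gamma_add_one hα.ne', one_rpow, Gamma_one, one_mul, ← le_div_iff₀' hα,
    one_div] at h

theorem Gamma_mul_add_two_le (hα : 0 < α) (hα1 : α < 1) (n : ℕ) :
    Gamma (α * ((n + 1 : ℕ) + 1)) ≤ (n + 1) ^ α * Gamma (α * (n + 1)) := by
  have : 0 < Gamma (α * (n + 1)) := Gamma_pos_of_pos (by positivity)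
  calc Gamma (α * ((n + 1 : ℕ) + 1)) = Gamma (α * (n + 1) + α) := by push_cast; ring_nf
    _ ≤ (α * (n + 1)) ^ α * Gamma (α * (n + 1)) := Gamma_add_le (by positivity) hα hα1
    _ ≤ (n + 1) ^ α * Gamma (α * (n + 1)) := by
        gcongr
        exact mul_le_of_le_one_left (by positivity) hα1.le

theorem Gamma_mul_succ_le (hα : 0 < α) (hα1 : α < 1) (n : ℕ) :
    Gamma (α * (n + 1)) ≤ n.factorial * Gamma α := by
  induction n with
  | zero => simp
  | succ n ih =>
    calc Gamma (α * ((n + 1 : ℕ) + 1)) ≤ (n + 1) ^ α * Gamma (α * (n + 1)) :=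
          Gamma_mul_add_two_le hα hα1 n
      _ ≤ (n + 1) * (n.factorial * Gamma α) := by
          gcongr
          exact rpow_le_self_of_one_le (by simp) hα1.le
      _ = (n + 1).factorial * Gamma α := by
          rw [Nat.factorial_succ]
          push_cast
          ring

theorem summable_Gamma_div_factorial_mul_pow (hα : 0 < α) (hα1 : α < 1) (hθ : 0 < θ) :
    Summable fun n : ℕ => Gamma (α * (n + 1)) / n.factorial * θ ^ n := by
  have hratio : Tendsto (fun n : ℕ => θ * ((n + 1 : ℕ) : ℝ) ^ (-(1 - α))) atTop (𝓝 (θ * 0)) :=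
    ((tendsto_rpow_neg_atTop (sub_pos.2 hα1)).comp
      (tendsto_natCast_atTop_atTop.comp (tendsto_add_atTop_nat 1))).const_mul θ
  rw [mul_zero] at hratio
  refine summable_of_ratio_norm_eventually_le one_half_lt_one ?_
  filter_upwards [hratio.eventually_le_const one_half_pos] with n hn
  have hΓ (m : ℕ) : 0 < Gamma (α * (m + 1)) := Gamma_pos_of_pos (by positivity)
  have := hΓ n
  rw [norm_of_nonneg (by have := hΓ (n + 1); positivity), norm_of_nonneg (by positivity)]
  calc Gamma (α * ((n + 1 : ℕ) + 1)) / (n + 1).factorial * θ ^ (n + 1)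
      ≤ (n + 1) ^ α * Gamma (α * (n + 1)) / (n + 1).factorial * θ ^ (n + 1) := by
        gcongr
        exact Gamma_mul_add_two_le hα hα1 n
    _ = θ * ((n + 1 : ℕ) : ℝ) ^ (-(1 - α)) * (Gamma (α * (n + 1)) / n.factorial * θ ^ n) := by
        rw [neg_sub, rpow_sub (by positivity), rpow_one, Nat.factorial_succ, pow_succ]
        push_cast
        field_simp
    _ ≤ 1 / 2 * (Gamma (α * (n + 1)) / n.factorial * θ ^ n) := by gcongr

/-- The coefficient of `(-θ) ^ n` in the power series of `h_α(θ)`. -/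
def wrightCoeff (α : ℝ) (n : ℕ) : ℝ :=
  (n.factorial : ℝ)⁻¹ * (Gamma (1 - α - α * n))⁻¹

theorem wrightDensity_eq_tsum (α θ : ℝ) :
    wrightDensity α θ = ∑' n : ℕ, (-θ) ^ n * wrightCoeff α n := rfl

theorem wrightDensity_zero (α : ℝ) : wrightDensity α 0 = (Gamma (1 - α))⁻¹ := by
  rw [wrightDensity_eq_tsum, tsum_eq_single 0 fun n hn => by simp [hn]]
  simp [wrightCoeff]

theorem wrightCoeff_eq (hα : 0 < α) (n : ℕ) :
    wrightCoeff α n = Gamma (α * (n + 1)) / n.factorial * sin (π * α * (n + 1)) / π := by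
  have hone_sub : 1 - α - α * n = 1 - α * (n + 1) := by ring
  rw [wrightCoeff, hone_sub, inv_Gamma_one_sub (by positivity), mul_assoc π]
  ring

theorem abs_wrightCoeff_le (hα : 0 < α) (n : ℕ) :
    |wrightCoeff α n| ≤ Gamma (α * (n + 1)) / n.factorial := by
  have : 0 < Gamma (α * (n + 1)) := Gamma_pos_of_pos (by positivity)
  rw [wrightCoeff_eq hα, mul_div_assoc, abs_mul, abs_of_pos (by positivity), abs_div,
    abs_of_pos pi_pos]
  refine mul_le_of_le_one_right (by positivity) ((div_le_one pi_pos).2 ?_)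
  exact (abs_sin_le_one _).trans (by linarith [pi_gt_three])

theorem norm_pow_mul_wrightCoeff_le {r : ℝ} (hα : 0 < α) (hθ : |θ| ≤ r) (n : ℕ) :
    ‖(-θ) ^ n * wrightCoeff α n‖ ≤ Gamma (α * (n + 1)) / n.factorial * r ^ n := by
  rw [norm_mul, norm_pow, norm_neg, norm_eq_abs, norm_eq_abs, mul_comm]
  have : 0 ≤ r := (abs_nonneg θ).trans hθ
  gcongr
  exact abs_wrightCoeff_le hα n

theorem abs_wrightDensity_le (hα : 0 < α) (hα1 : α < 1) (hθ : |θ| ≤ 1 / 2) :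
    |wrightDensity α θ| ≤ 2 * α⁻¹ := by
  rw [wrightDensity_eq_tsum, ← norm_eq_abs]
  refine tsum_of_norm_bounded (hasSum_geometric_two.mul_right α⁻¹) fun n => ?_
  refine (norm_pow_mul_wrightCoeff_le hα hθ n).trans ?_
  rw [mul_comm]
  gcongr
  rw [div_le_iff₀' (by positivity)]
  exact (Gamma_mul_succ_le hα hα1 n).trans (by gcongr; exact Gamma_le_inv hα hα1)

theorem continuous_wrightDensity (hα : 0 < α) (hα1 : α < 1) : Continuous (wrightDensity α) := by
  refine continuous_iff_continuousAt.2 fun θ => ?_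
  have hnhds : {x : ℝ | |x| < |θ| + 1} ∈ 𝓝 θ :=
    (isOpen_lt continuous_abs continuous_const).mem_nhds (lt_add_one |θ|)
  refine ContinuousOn.continuousAt ?_ hnhds
  exact continuousOn_tsum (fun n => by fun_prop)
    (summable_Gamma_div_factorial_mul_pow hα hα1 (by positivity)) fun n x hx =>
      norm_pow_mul_wrightCoeff_le hα (le_of_lt hx) n

theorem exists_wrightMass_of_mem_Ioo (hα : 0 < α) (hα1 : α < 1) : ∃ a b c, WrightMass α a b c := by
  have hzero : 0 < wrightDensity α 0 := by
    rw [wrightDensity_zero]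
    exact inv_pos.2 (Gamma_pos_of_pos (sub_pos.2 hα1))
  obtain ⟨δ, hδ, hlt⟩ := Metric.eventually_nhds_iff.1
    ((continuous_wrightDensity hα hα1).continuousAt.eventually
      (lt_mem_nhds (half_lt_self hzero)))
  refine ⟨δ / 4, δ / 2, wrightDensity α 0 / 2 * (δ / 4), by positivity, by positivity,
    by positivity, ?_⟩
  calc ENNReal.ofReal (wrightDensity α 0 / 2 * (δ / 4))
      = ∫⁻ _ in Ioc (δ / 4) (δ / 2), ENNReal.ofReal (wrightDensity α 0 / 2) := by
        rw [setLIntegral_const, volume_Ioc, ENNReal.ofReal_mul (by positivity)]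
        congr 2
        ring
    _ ≤ ∫⁻ θ in Ioc (δ / 4) (δ / 2), ENNReal.ofReal (wrightDensity α θ) := by
        refine setLIntegral_mono' measurableSet_Ioc fun θ hθ =>
          ENNReal.ofReal_le_ofReal (hlt ?_).le
        rw [dist_eq, sub_zero, abs_of_pos (by linarith [hθ.1])]
        linarith [hθ.2]

theorem hasSum_integral_wrightDensity (hα : 0 < α) (hα1 : α < 1) (hθ : 0 < θ) :
    HasSum (fun n : ℕ => (-1) ^ n * (θ ^ (n + 1) / (n + 1)) * wrightCoeff α n)
      (∫ x in (0 : ℝ)..θ, wrightDensity α x) := by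
  have hsummable := summable_Gamma_div_factorial_mul_pow hα hα1 hθ
  have hbound (n : ℕ) (x : ℝ) (hx : x ∈ uIoc 0 θ) :
      ‖(-x) ^ n * wrightCoeff α n‖ ≤ Gamma (α * (n + 1)) / n.factorial * θ ^ n := by
    rw [uIoc_of_le hθ.le] at hx
    exact norm_pow_mul_wrightCoeff_le hα (by rw [abs_of_pos hx.1]; exact hx.2) n
  have hterm (n : ℕ) : ∫ x in (0 : ℝ)..θ, (-x) ^ n * wrightCoeff α n =
      (-1) ^ n * (θ ^ (n + 1) / (n + 1)) * wrightCoeff α n := by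
    have hneg : (fun x : ℝ => (-x) ^ n * wrightCoeff α n) =
        fun x => x ^ n * ((-1) ^ n * wrightCoeff α n) := by
      funext x
      rw [neg_pow]
      ring
    rw [hneg, intervalIntegral.integral_mul_const, integral_pow, zero_pow n.succ_ne_zero, sub_zero]
    ring
  simp only [← hterm]
  exact intervalIntegral.hasSum_integral_of_dominated_convergence
    (fun n _ => Gamma (α * (n + 1)) / n.factorial * θ ^ n) (fun n => by fun_prop)
    (fun n => ae_of_all _ (hbound n)) (ae_of_all _ fun _ _ => hsummable)
    intervalIntegrable_const
    (ae_of_all _ fun x hx => (hsummable.of_norm_bounded fun n => hbound n x hx).hasSum)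

theorem integrable_of_summable_integral_norm {X : Type*} [MeasurableSpace X] {μ : Measure X}
    {F : ℕ → X → ℝ} {f : X → ℝ} (hF : ∀ n, Integrable (F n) μ)
    (hsum : Summable fun n => ∫ x, ‖F n x‖ ∂μ) (hf : ∀ᵐ x ∂μ, HasSum (fun n => F n x) (f x)) :
    Integrable f μ := by
  refine ⟨aestronglyMeasurable_of_tendsto_ae atTop
    (f := fun n x => ∑ i ∈ Finset.range n, F i x)
    (fun n => (integrable_finsetSum _ fun i _ => hF i).aestronglyMeasurable)
    (hf.mono fun x hx => hx.tendsto_sum_nat), ?_⟩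
  calc ∫⁻ x, ‖f x‖ₑ ∂μ ≤ ∫⁻ x, ∑' n, ‖F n x‖ₑ ∂μ := by
        refine lintegral_mono_ae (hf.mono fun x hx => ?_)
        rw [← hx.tsum_eq]
        exact enorm_tsum_le_tsum_enorm
    _ = ∑' n, ENNReal.ofReal (∫ x, ‖F n x‖ ∂μ) := by
        rw [lintegral_tsum fun n => (hF n).aestronglyMeasurable.enorm]
        simp only [ofReal_integral_norm_eq_lintegral_enorm (hF _)]
    _ < ∞ := hsum.tsum_ofReal_lt_top

/-- `e^{-x cos φ} sin (x sin φ)` is the imaginary part of `-exp (-x e^{iφ})`. -/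
theorem hasSum_pow_succ_mul_sin (x φ : ℝ) :
    HasSum (fun n : ℕ => (-1) ^ n * (x ^ (n + 1) / (n + 1).factorial) * sin (φ * (n + 1)))
      (exp (-(x * cos φ)) * sin (x * sin φ)) := by
  have hexp := NormedSpace.expSeries_div_hasSum_exp ((-x : ℝ) * Complex.exp (φ * Complex.I))
  rw [← Complex.exp_eq_exp_ℂ] at hexp
  have him := ((hasSum_nat_add_iff' 1).2 (Complex.hasSum_im hexp)).neg
  have hterm (n : ℕ) : (((-x : ℝ) * Complex.exp (φ * Complex.I)) ^ n / n.factorial).im =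
      (-x) ^ n / n.factorial * sin (φ * n) := by
    have harg : (n : ℂ) * (φ * Complex.I) = ((φ * n : ℝ) : ℂ) * Complex.I := by
      push_cast
      ring
    have hcoeff : ((-x : ℝ) : ℂ) ^ n / n.factorial = (((-x) ^ n / n.factorial : ℝ) : ℂ) := by
      push_cast
      ring
    rw [mul_pow, ← Complex.exp_nat_mul, mul_div_right_comm, harg, hcoeff, Complex.im_ofReal_mul,
      Complex.exp_ofReal_mul_I_im]
  have hvalue : exp (-(x * cos φ)) * sin (x * sin φ) =
      -((Complex.exp ((-x : ℝ) * Complex.exp (φ * Complex.I))).im -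
        ∑ i ∈ Finset.range 1, (((-x : ℝ) * Complex.exp (φ * Complex.I)) ^ i / i.factorial).im) := by
    rw [Finset.sum_range_one, hterm, Complex.exp_im, Complex.re_ofReal_mul, Complex.im_ofReal_mul,
      Complex.exp_ofReal_mul_I_re, Complex.exp_ofReal_mul_I_im, neg_mul, neg_mul, sin_neg]
    simp
  rw [hvalue]
  refine him.congr_fun fun n => ?_
  rw [hterm, neg_pow x, pow_succ (-1 : ℝ)]
  push_cast
  ring

/-- The integrand `e^{-r} r⁻¹ e^{-θ r^α cos πα} sin (θ r^α sin πα)`, whose integral over `(0, ∞)` is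
`π` times the distribution function of `h_α` at `θ`. -/
def wrightKernel (α θ r : ℝ) : ℝ :=
  exp (-r - θ * r ^ α * cos (π * α)) * sin (θ * r ^ α * sin (π * α)) / r

/-- The `n`-th term of the expansion of `wrightKernel α θ r` in powers of `θ`. -/
def wrightKernelTerm (α θ : ℝ) (n : ℕ) (r : ℝ) : ℝ :=
  (-1) ^ n * sin (π * α * (n + 1)) * (θ ^ (n + 1) / (n + 1).factorial) *
    (exp (-r) * r ^ (α * (n + 1) - 1))

theorem integrableOn_wrightKernelTerm (hα : 0 < α) (θ : ℝ) (n : ℕ) :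
    IntegrableOn (wrightKernelTerm α θ n) (Ioi 0) :=
  (GammaIntegral_convergent (by positivity)).const_mul _

theorem hasSum_wrightKernelTerm {r : ℝ} (hr : 0 < r) :
    HasSum (fun n => wrightKernelTerm α θ n r) (wrightKernel α θ r) := by
  have hkernel : wrightKernel α θ r = exp (-r) / r *
      (exp (-(θ * r ^ α * cos (π * α))) * sin (θ * r ^ α * sin (π * α))) := by
    rw [wrightKernel, sub_eq_add_neg, exp_add]
    ring
  rw [hkernel]
  refine ((hasSum_pow_succ_mul_sin (θ * r ^ α) (π * α)).mul_left (exp (-r) / r)).congr_fun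
    fun n => ?_
  have hpow : r ^ (α * (n + 1) - 1) = (r ^ α) ^ (n + 1) / r := by
    rw [rpow_sub_one hr.ne', rpow_mul hr.le, ← rpow_natCast]
    push_cast
    rfl
  rw [wrightKernelTerm, hpow, mul_pow]
  ring

theorem integral_wrightKernelTerm (hα : 0 < α) (θ : ℝ) (n : ℕ) :
    ∫ r in Ioi 0, wrightKernelTerm α θ n r =
      π * ((-1) ^ n * (θ ^ (n + 1) / (n + 1)) * wrightCoeff α n) := by
  simp only [wrightKernelTerm, integral_const_mul]
  rw [← Gamma_eq_integral (by positivity), wrightCoeff_eq hα, Nat.factorial_succ]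
  push_cast
  field_simp

theorem summable_integral_norm_wrightKernelTerm (hα : 0 < α) (hα1 : α < 1) (hθ : 0 < θ) :
    Summable fun n : ℕ => ∫ r in Ioi 0, ‖wrightKernelTerm α θ n r‖ := by
  refine ((summable_Gamma_div_factorial_mul_pow hα hα1 hθ).mul_left θ).of_nonneg_of_le
    (fun n => integral_nonneg fun r => norm_nonneg _) fun n => ?_
  have hintegrable := GammaIntegral_convergent (s := α * (n + 1)) (by positivity)
  have : 0 < Gamma (α * (n + 1)) := Gamma_pos_of_pos (by positivity)
  have hcoeff : |(-1) ^ n * sin (π * α * (n + 1)) * (θ ^ (n + 1) / (n + 1).factorial)| ≤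
      θ ^ (n + 1) / n.factorial := by
    have hpos : 0 < θ ^ (n + 1) / (n + 1).factorial := by positivity
    rw [abs_mul, abs_mul, abs_neg_one_pow, one_mul, abs_of_pos hpos]
    refine (mul_le_of_le_one_left (by positivity) (abs_sin_le_one _)).trans ?_
    gcongr
    exact n.le_succ
  calc ∫ r in Ioi 0, ‖wrightKernelTerm α θ n r‖
      ≤ ∫ r in Ioi 0, θ ^ (n + 1) / n.factorial * (exp (-r) * r ^ (α * (n + 1) - 1)) := by
        refine setIntegral_mono_on (integrableOn_wrightKernelTerm hα θ n).norm
          (hintegrable.const_mul _) measurableSet_Ioi fun r hr => ?_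
        have hr0 : 0 < r := hr
        rw [wrightKernelTerm, norm_mul, norm_eq_abs, norm_of_nonneg (by positivity)]
        gcongr
    _ = θ * (Gamma (α * (n + 1)) / n.factorial * θ ^ n) := by
        rw [integral_const_mul, ← Gamma_eq_integral (by positivity)]
        ring

theorem integrableOn_wrightKernel (hα : 0 < α) (hα1 : α < 1) (hθ : 0 < θ) :
    IntegrableOn (wrightKernel α θ) (Ioi 0) :=
  integrable_of_summable_integral_norm (integrableOn_wrightKernelTerm hα θ)
    (summable_integral_norm_wrightKernelTerm hα hα1 hθ)
    (ae_restrict_of_forall_mem measurableSet_Ioi fun _ hr => hasSum_wrightKernelTerm hr)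

theorem integral_wrightKernel (hα : 0 < α) (hα1 : α < 1) (hθ : 0 < θ) :
    ∫ r in Ioi 0, wrightKernel α θ r = π * ∫ x in (0 : ℝ)..θ, wrightDensity α x := by
  have hsum := hasSum_integral_of_summable_integral_norm (integrableOn_wrightKernelTerm hα θ)
    (summable_integral_norm_wrightKernelTerm hα hα1 hθ)
  simp only [integral_wrightKernelTerm hα] at hsum
  rw [((hasSum_integral_wrightDensity hα hα1 hθ).mul_left π).unique hsum]
  exact setIntegral_congr_fun measurableSet_Ioi fun r hr =>
    (hasSum_wrightKernelTerm hr).tsum_eq.symm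

end WrightDensity

/-! ### The mass of h_α as α tends to 1 -/

section UniformMass

theorem quadratic_div_pi_le_sin {y : ℝ} (hy : 0 ≤ y) : (2 * y - y ^ 2) / π ≤ sin y := by
  have hpi3 := pi_gt_three
  have hpi4 := pi_lt_four
  rw [div_le_iff₀ pi_pos]
  have hjordan {z : ℝ} (hz : 0 ≤ z) (hz' : z ≤ π / 2) : 2 * z ≤ sin z * π := by
    rw [← div_le_iff₀ pi_pos, ← div_mul_eq_mul_div]
    exact mul_le_sin hz hz'
  rcases le_total y (π / 2) with h | h
  · linarith [hjordan hy h, sq_nonneg y]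
  rcases le_total y π with h' | h'
  · have := hjordan (z := π - y) (by linarith) (by linarith)
    rw [sin_pi_sub] at this
    nlinarith [sq_nonneg (y - 2)]
  · have := sin_le (x := y - π) (by linarith)
    rw [sin_sub_pi] at this
    nlinarith

theorem exp_neg_mul_quadratic_le_exp_mul_sin {x y : ℝ} (hy : 0 ≤ y) (hle : y ≤ π → -y ≤ x)
    (hge : π ≤ y → x ≤ -y) : exp (-y) * ((2 * y - y ^ 2) / π) ≤ exp x * sin y := by
  have hsin := quadratic_div_pi_le_sin hy
  rcases le_total y π with h | h
  · calc exp (-y) * ((2 * y - y ^ 2) / π) ≤ exp (-y) * sin y := by gcongr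
      _ ≤ exp x * sin y := by
        have := sin_nonneg_of_nonneg_of_le_pi hy h
        gcongr
        exact hle h
  · have hneg : (2 * y - y ^ 2) / π ≤ 0 :=
      div_nonpos_of_nonpos_of_nonneg (by nlinarith [pi_gt_three]) pi_pos.le
    calc exp (-y) * ((2 * y - y ^ 2) / π) ≤ exp x * ((2 * y - y ^ 2) / π) :=
          mul_le_mul_of_nonpos_right (exp_le_exp.2 (hge h)) hneg
      _ ≤ exp x * sin y := by gcongr

variable {α θ l : ℝ}

theorem exp_neg_mul_quadratic_div_eq {r : ℝ} (hr : 0 < r) :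
    exp (-(l * r ^ α)) * ((2 * (l * r ^ α) - (l * r ^ α) ^ 2) / π) / r =
      2 * l / π * (r ^ (α - 1) * exp (-l * r ^ α)) -
        l ^ 2 / π * (r ^ (2 * α - 1) * exp (-l * r ^ α)) := by
  rw [rpow_sub_one hr.ne', rpow_sub_one hr.ne', mul_comm 2 α, rpow_mul hr.le, rpow_two, neg_mul]
  ring

theorem integrableOn_exp_neg_mul_quadratic (hα : 0 < α) (hl : 0 < l) :
    IntegrableOn (fun r => exp (-(l * r ^ α)) * ((2 * (l * r ^ α) - (l * r ^ α) ^ 2) / π) / r)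
      (Ioi 0) := by
  have hint₁ := integrableOn_rpow_mul_exp_neg_mul_rpow (s := α - 1) (by linarith) hα hl
  have hint₂ := integrableOn_rpow_mul_exp_neg_mul_rpow (s := 2 * α - 1) (by linarith) hα hl
  exact IntegrableOn.congr_fun (Integrable.sub (Integrable.const_mul hint₁ (2 * l / π))
    (Integrable.const_mul hint₂ (l ^ 2 / π)))
    (fun _ hr => (exp_neg_mul_quadratic_div_eq hr).symm) measurableSet_Ioi

theorem integral_exp_neg_mul_quadratic (hα : 0 < α) (hl : 0 < l) :
    ∫ r in Ioi 0, exp (-(l * r ^ α)) * ((2 * (l * r ^ α) - (l * r ^ α) ^ 2) / π) / r =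
      (π * α)⁻¹ := by
  have hmoment (m : ℝ) (hm : 0 < m) :
      IntegrableOn (fun r => r ^ (m * α - 1) * exp (-l * r ^ α)) (Ioi 0) ∧
        ∫ r in Ioi 0, r ^ (m * α - 1) * exp (-l * r ^ α) = l ^ (-m) * α⁻¹ * Gamma m := by
    have hexponent : -1 < m * α - 1 := by linarith [mul_pos hm hα]
    refine ⟨integrableOn_rpow_mul_exp_neg_mul_rpow hexponent hα hl, ?_⟩
    rw [integral_rpow_mul_exp_neg_mul_rpow hα hexponent hl, sub_add_cancel, neg_div,
      mul_div_cancel_right₀ m hα.ne', one_div]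
  obtain ⟨hint₁, heq₁⟩ := hmoment 1 one_pos
  obtain ⟨hint₂, heq₂⟩ := hmoment 2 two_pos
  rw [one_mul] at hint₁ heq₁
  rw [setIntegral_congr_fun measurableSet_Ioi fun r hr => exp_neg_mul_quadratic_div_eq hr,
    integral_sub (hint₁.const_mul _) (hint₂.const_mul _), integral_const_mul, integral_const_mul,
    heq₁, heq₂, Gamma_one, Gamma_two, rpow_neg hl.le, rpow_neg hl.le, rpow_one, rpow_two]
  field_simp
  norm_num

/-- The hypotheses place the sign change of `sin (θ r^α sin πα)` at the point where the exponential
factor of `wrightKernel` crosses `e^{-θ r^α sin πα}`. The kernel then dominates a function whose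
integral does not depend on `θ`. -/
theorem inv_le_integral_wrightDensity (hα : 0 < α) (hα1 : α < 1) (hθ : 0 < θ)
    (hle : ∀ r, 0 < r → θ * sin (π * α) * r ^ α ≤ π →
      r ≤ θ * (sin (π * α) - cos (π * α)) * r ^ α)
    (hge : ∀ r, 0 < r → π ≤ θ * sin (π * α) * r ^ α →
      θ * (sin (π * α) - cos (π * α)) * r ^ α ≤ r) :
    (π ^ 2 * α)⁻¹ ≤ ∫ x in (0 : ℝ)..θ, wrightDensity α x := by
  have hsin : 0 < sin (π * α) :=
    sin_pos_of_pos_of_lt_pi (by positivity) (mul_lt_of_lt_one_right pi_pos hα1)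
  have hkernel : (π * α)⁻¹ ≤ ∫ r in Ioi 0, wrightKernel α θ r := by
    rw [← integral_exp_neg_mul_quadratic hα (mul_pos hθ hsin)]
    refine setIntegral_mono_on (integrableOn_exp_neg_mul_quadratic hα (mul_pos hθ hsin))
      (integrableOn_wrightKernel hα hα1 hθ) measurableSet_Ioi fun r hr => ?_
    have hr0 : 0 < r := hr
    rw [wrightKernel, mul_right_comm θ (r ^ α) (sin _)]
    refine div_le_div_of_nonneg_right (exp_neg_mul_quadratic_le_exp_mul_sin (by positivity)
      (fun h => ?_) fun h => ?_) hr0.le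
    · linarith [hle r hr0 h]
    · linarith [hge r hr0 h]
  rw [integral_wrightKernel hα hα1 hθ] at hkernel
  calc (π ^ 2 * α)⁻¹ = π⁻¹ * (π * α)⁻¹ := by rw [sq, mul_assoc, mul_inv]
    _ ≤ π⁻¹ * (π * ∫ x in (0 : ℝ)..θ, wrightDensity α x) := by gcongr
    _ = _ := inv_mul_cancel_left₀ pi_pos.ne' _

theorem le_rpow_one_sub_mul_rpow {r ρ : ℝ} (hα1 : α ≤ 1) (hr : 0 < r) (h : r ≤ ρ) :
    r ≤ ρ ^ (1 - α) * r ^ α := by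
  calc r = r ^ (1 - α) * r ^ α := by rw [← rpow_add hr, sub_add_cancel, rpow_one]
    _ ≤ ρ ^ (1 - α) * r ^ α := by gcongr

theorem rpow_one_sub_mul_rpow_le {r ρ : ℝ} (hα1 : α ≤ 1) (hρ : 0 < ρ) (h : ρ ≤ r) :
    ρ ^ (1 - α) * r ^ α ≤ r := by
  have hr := hρ.trans_le h
  calc ρ ^ (1 - α) * r ^ α ≤ r ^ (1 - α) * r ^ α := by gcongr
    _ = r := by rw [← rpow_add hr, sub_add_cancel, rpow_one]

theorem inv_le_integral_wrightDensity_rpow_div {m : ℝ} (hα : 0 < α) (hα1 : α < 1)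
    (hm : sin (π * α) - cos (π * α) = m) (hm0 : 0 < m) :
    (π ^ 2 * α)⁻¹ ≤
      ∫ x in (0 : ℝ)..(π * m / sin (π * α)) ^ (1 - α) / m, wrightDensity α x := by
  have hsin : 0 < sin (π * α) :=
    sin_pos_of_pos_of_lt_pi (by positivity) (mul_lt_of_lt_one_right pi_pos hα1)
  set ρ := π * m / sin (π * α) with hρdef
  have hρ : 0 < ρ := by positivity
  have hm_mul : ρ ^ (1 - α) / m * m = ρ ^ (1 - α) := div_mul_cancel₀ _ hm0.ne'
  have hsin_mul : ρ ^ (1 - α) / m * sin (π * α) * ρ ^ α = π := by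
    have hsplit : ρ ^ (1 - α) * ρ ^ α = ρ := by rw [← rpow_add hρ, sub_add_cancel, rpow_one]
    rw [mul_right_comm, div_mul_eq_mul_div, hsplit, hρdef]
    field_simp
  have hpos : 0 < ρ ^ (1 - α) / m * sin (π * α) := by positivity
  refine inv_le_integral_wrightDensity hα hα1 (by positivity) (fun r hr h => ?_) fun r hr h => ?_
  all_goals rw [hm, hm_mul]
  · have hrρ := h.trans_eq hsin_mul.symm
    rw [mul_le_mul_iff_right₀ hpos, rpow_le_rpow_iff hr.le hρ.le hα] at hrρ
    exact le_rpow_one_sub_mul_rpow hα1.le hr hrρ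
  · have hρr := hsin_mul.trans_le h
    rw [mul_le_mul_iff_right₀ hpos, rpow_le_rpow_iff hρ.le hr.le hα] at hρr
    exact rpow_one_sub_mul_rpow_le hα1.le hρ hρr

theorem two_mul_one_sub_le_sin_pi_mul (hα : 1 / 2 ≤ α) (hα1 : α ≤ 1) :
    2 * (1 - α) ≤ sin (π * α) := by
  have hpi := pi_pos
  have hjordan := mul_le_sin (x := π - π * α) (by nlinarith) (by nlinarith)
  rw [sin_pi_sub] at hjordan
  calc 2 * (1 - α) = 2 / π * (π - π * α) := by field_simp
    _ ≤ sin (π * α) := hjordan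

theorem rpow_one_sub_le_exp {ρ x : ℝ} (hα1 : α ≤ 1) (hρ : 0 < ρ) (h : ρ * (1 - α) ≤ x) :
    ρ ^ (1 - α) ≤ exp x := by
  rw [rpow_def_of_pos hρ, exp_le_exp]
  exact (mul_le_mul_of_nonneg_right (log_le_self hρ.le) (sub_nonneg.2 hα1)).trans h

theorem exists_inv_sq_pi_le_integral_wrightDensity (hα : 1 / 2 < α) (hα1 : α < 1) :
    ∃ θ, 1 / 2 ≤ θ ∧ θ ≤ exp π ∧ (π ^ 2)⁻¹ ≤ ∫ x in (0 : ℝ)..θ, wrightDensity α x := by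
  have hpi := pi_gt_three
  have hα0 : 0 < α := by linarith
  have hsin := two_mul_one_sub_le_sin_pi_mul hα.le hα1.le
  have hsin0 : 0 < sin (π * α) := by linarith
  have hcos : cos (π * α) < 0 := cos_neg_of_pi_div_two_lt_of_lt (by nlinarith) (by nlinarith)
  set m := sin (π * α) - cos (π * α) with hm
  have hm1 : 1 ≤ m := by nlinarith [sin_sq_add_cos_sq (π * α)]
  have hm2 : m ≤ 2 := by linarith [sin_le_one (π * α), neg_one_le_cos (π * α)]
  have hρ1 : 1 ≤ π * m / sin (π * α) := by
    rw [one_le_div hsin0]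
    nlinarith [sin_le_one (π * α)]
  refine ⟨(π * m / sin (π * α)) ^ (1 - α) / m, ?_, ?_, ?_⟩
  · have := one_le_rpow hρ1 (sub_nonneg.2 hα1.le)
    gcongr
  · refine (div_le_self (by positivity) hm1).trans ?_
    refine rpow_one_sub_le_exp hα1.le (one_pos.trans_le hρ1) ?_
    rw [div_mul_eq_mul_div, div_le_iff₀ hsin0, mul_assoc]
    gcongr
    nlinarith
  · refine le_trans ?_
      (inv_le_integral_wrightDensity_rpow_div hα0 hα1 hm.symm (one_pos.trans_le hm1))
    gcongr
    exact mul_le_of_le_one_right (by positivity) hα1.le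

theorem ofReal_setIntegral_le {f : ℝ → ℝ} {s : Set ℝ} (hf : IntegrableOn f s) :
    ENNReal.ofReal (∫ x in s, f x) ≤ ∫⁻ x in s, ENNReal.ofReal (f x) := by
  rw [integral_eq_lintegral_pos_part_sub_lintegral_neg_part hf]
  refine (ENNReal.ofReal_le_ofReal (sub_le_self _ ENNReal.toReal_nonneg)).trans ?_
  exact ENNReal.ofReal_toReal_le

theorem intervalIntegral_wrightDensity_le (hα : 1 / 2 < α) (hα1 : α < 1) :
    ∫ x in (0 : ℝ)..(1 / 80), wrightDensity α x ≤ 1 / 20 := by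
  have hα0 : 0 < α := by linarith
  have hbound (x : ℝ) (hx : x ∈ uIoc 0 (1 / 80)) : ‖wrightDensity α x‖ ≤ 4 := by
    rw [uIoc_of_le (by norm_num)] at hx
    have hinv : α⁻¹ ≤ 2 := by
      rw [inv_le_comm₀ hα0 two_pos]
      linarith
    have hx' : |x| ≤ 1 / 2 := by
      rw [abs_of_pos hx.1]
      linarith [hx.2]
    exact (abs_wrightDensity_le hα0 hα1 hx').trans (by linarith)
  refine (le_norm_self _).trans
    ((intervalIntegral.norm_integral_le_of_norm_le_const hbound).trans (le_of_eq ?_))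
  norm_num

theorem wrightMass_uniform (hα : 1 / 2 < α) (hα1 : α < 1) :
    WrightMass α (1 / 80) (exp π) (1 / 20) := by
  refine ⟨by norm_num, exp_pos π, by norm_num, ?_⟩
  obtain ⟨θ, hθ, hθ', hmass⟩ := exists_inv_sq_pi_le_integral_wrightDensity hα hα1
  have hintegrable (x y : ℝ) : IntervalIntegrable (wrightDensity α) volume x y :=
    (continuous_wrightDensity (by linarith) hα1).intervalIntegrable x y
  have hpi : (1 : ℝ) / 10 ≤ (π ^ 2)⁻¹ := by
    rw [one_div]
    exact inv_anti₀ (by positivity) (by nlinarith [pi_lt_d2, pi_pos])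
  have hsplit := intervalIntegral.integral_add_adjacent_intervals
    (hintegrable 0 (1 / 80)) (hintegrable (1 / 80) θ)
  have hge : 1 / 20 ≤ ∫ x in Ioc (1 / 80) θ, wrightDensity α x := by
    rw [← intervalIntegral.integral_of_le (by linarith)]
    linarith [intervalIntegral_wrightDensity_le hα hα1]
  calc ENNReal.ofReal (1 / 20) ≤ ENNReal.ofReal (∫ x in Ioc (1 / 80) θ, wrightDensity α x) :=
        ENNReal.ofReal_le_ofReal hge
    _ ≤ ∫⁻ x in Ioc (1 / 80) θ, ENNReal.ofReal (wrightDensity α x) :=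
        ofReal_setIntegral_le (hintegrable _ _).1
    _ ≤ ∫⁻ x in Ioc (1 / 80) (exp π), ENNReal.ofReal (wrightDensity α x) :=
        lintegral_mono_set (Ioc_subset_Ioc_right hθ')

theorem exists_wrightMass (hα : α ∈ Ioo 0 1) :
    ∃ a b c, WrightMass α a b c ∧ (1 / 2 < α → a = 1 / 80 ∧ b = exp π ∧ c = 1 / 20) := by
  by_cases hhalf : 1 / 2 < α
  · exact ⟨_, _, _, wrightMass_uniform hhalf hα.2, fun _ => ⟨rfl, rfl, rfl⟩⟩
  · obtain ⟨a, b, c, hw⟩ := exists_wrightMass_of_mem_Ioo hα.1 hα.2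
    exact ⟨a, b, c, hw, fun h => absurd h hhalf⟩

theorem one_sub_div_rpow_mem_Icc {q : ℝ} (hα : 1 / 2 < α) (hα1 : α < 1) (hq : 0 ≤ q) :
    ((1 - α) / α) ^ q ∈ Icc ((1 - α) ^ q) (2 ^ q * (1 - α) ^ q) := by
  have hα0 : 0 < α := by linarith
  have hsub : 0 < 1 - α := sub_pos.2 hα1
  rw [← mul_rpow two_pos.le hsub.le]
  constructor
  · exact rpow_le_rpow hsub.le (le_div_self hsub.le hα0 hα1.le) hq
  · refine rpow_le_rpow (by positivity) ?_ hq
    rw [div_le_iff₀ hα0]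
    nlinarith

end UniformMass

end TimeFracHeat

end

theorem mainTheorem8 (N : ℕ) (hN : 1 ≤ N) :
    ∃ κ₁ : ℝ → ℝ,
      (∀ α ∈ Set.Ioo (0 : ℝ) 1, 0 < κ₁ α) ∧
      (∀ α ∈ Set.Ioo (0 : ℝ) 1, ∀ κ : ℝ, κ₁ α < κ →
        ∃ Cκ : ℝ, 0 < Cκ ∧ ∀ j : ℕ, 1 ≤ j →
          TimeFracHeat.lifespan α (TimeFracHeat.fujita N) (TimeFracHeat.initialDatum N κ j) ≤
            ENNReal.ofReal (Cκ * (j : ℝ) ^ (-(2 / (α * (N : ℝ)))))) ∧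
      (∃ c C : ℝ, 0 < c ∧ c ≤ C ∧ ∀ᶠ α : ℝ in 𝓝[<] (1 : ℝ),
        c * (1 - α) ^ ((N : ℝ) / 2) ≤ κ₁ α ∧ κ₁ α ≤ C * (1 - α) ^ ((N : ℝ) / 2)) ∧
      (∀ α ∈ Set.Ioo (0 : ℝ) 1, ∃ K C : ℝ, 0 < K ∧ 0 < C ∧
        ∀ κ : ℝ, K < κ → ∀ j : ℕ, 1 ≤ j →
          TimeFracHeat.lifespan α (TimeFracHeat.fujita N) (TimeFracHeat.initialDatum N κ j) ≤
            ENNReal.ofReal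
              (C * κ ^ (-(2 / (α * (N : ℝ)))) * (j : ℝ) ^ (-(2 / (α * (N : ℝ)))))) := by
  open TimeFracHeat in
  choose! a b c hw huniform using fun (α : ℝ) (hα : α ∈ Set.Ioo 0 1) => exists_wrightMass hα
  let A (α : ℝ) : ℝ := thresholdConst N (a α) (b α) (c α)
  refine ⟨fun α => A α * ((1 - α) / α) ^ ((N : ℝ) / 2), fun α hα => ?_, fun α hα κ hκ => ?_, ?_,
    fun α hα => ?_⟩
  · exact mul_pos ((hw α hα).thresholdConst_pos N)
      (Real.rpow_pos_of_pos (div_pos (sub_pos.2 hα.2) hα.1) _)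
  · obtain ⟨C, hC, hbound⟩ :=
      (hw α hα).exists_forall_le_of_thresholdConst_lt hN hα.1 hα.2 hκ
    exact ⟨C, hC, fun j hj => lifespan_le (hbound j hj)⟩
  · have hA := (wrightMass_uniform (α := 3 / 4) (by norm_num) (by norm_num)).thresholdConst_pos N
    refine ⟨_, _, hA, le_mul_of_one_le_right hA.le
      (Real.one_le_rpow one_le_two (by positivity : (0 : ℝ) ≤ N / 2)), ?_⟩
    filter_upwards [Ioo_mem_nhdsLT one_half_lt_one] with α hα
    obtain ⟨ha, hb, hc⟩ := huniform α ⟨one_half_pos.trans hα.1, hα.2⟩ hα.1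
    obtain ⟨hlower, hupper⟩ := one_sub_div_rpow_mem_Icc (q := N / 2) hα.1 hα.2 (by positivity)
    simp only [A, ha, hb, hc, mul_assoc]
    exact ⟨mul_le_mul_of_nonneg_left hlower hA.le, mul_le_mul_of_nonneg_left hupper hA.le⟩
  · obtain ⟨K, C, hK, hC, hbound⟩ := (hw α hα).exists_forall_le_of_large hN hα.1 hα.2.le
    exact ⟨K, C, hK, hC, fun κ hκ j hj => lifespan_le (hbound κ hκ j hj)⟩
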